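/- **Setting.** Let $\Omega$ be a measurable space with a finite reference measure $dx$ (for instance a set $\Omega\subset\mathbb R^d$ of finite Lebesgue measure), and let $p_0:\Omega\to\mathbb R$ be measurable with $0<c_0\le p_0\le C_0$ (normalized or not; $p_0\equiv1$ is allowed). Let $\mathcal H$ be a separable reproducing kernel Hilbert space of real functions on $\Omega$ whose kernel $k$ is measurable and bounded, $k(x,x')\le\kappa$ for all $x,x'$. For $f\in\mathcal H$ put $p_f=p_0\exp(f-A(f))$, $A(f)=\log\int_\Omega e^{f}p_0\,dx$. Let $\mathcal F\subset\mathcal H$ be convex with $\|f\|_{\mathcal H}\le C_{\mathcal H}$ for all $f\in\mathcal F$, let $f^*\in\mathcal F$, and let $p^*=p_{f^*}$. Let $\zeta_1\ge\zeta_2\ge\dots\ge 0$ be the eigenvalues, repeated according to multiplicity (and continued by $0$ if there are only finitely many positive ones), of the integral operator $g\mapsto\int_\Omega k(\cdot,y)g(y)p^*(y)\,dy$ on $L^2(p^*)$, and assume $\zeta_l=O(l^{-r})$ for some $r>1$. Let $x_1,\dots,x_n$ be i.i.d. with density $p^*$, and let $\eta>0$. Let $\mathcal P_w$ be a set of probability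 densities on $\Omega$ with $q(x)\le C_{\mathcal P}$ for all $q\in\mathcal P_w$, $x\in\Omega$. Put $$\tilde\ell(f,\nu,q)=\frac1n\sum_{i=1}^n f(x_i)-\mathbb E_q[f]-\frac\eta2\|f\|_{\mathcal H}^2+\mathbb E_q[\nu]-\mathbb E_{p_0}[e^{\nu}],\qquad \mathbb E_{p_0}[h]=\int_\Omega h\,p_0\,dx ,$$ and $\ell(f,q)=\sup_\nu\tilde\ell(f,\nu,q)$, where $\nu$ runs over all measurable functions $\Omega\to\mathbb R$ for which $\mathbb E_q[\nu]$ and $\mathbb E_{p_0}[e^\nu]$ are finite. A *doubly dual saddle point* is a pair $(\tilde f,\tilde q)\in\mathcal F\times\mathcal P_w$ with $\ell(f,\tilde q)\le\ell(\tilde f,\tilde q)\le\ell(\tilde f,q)$ for all $f\in\mathcal F$, $q\in\mathcal P_w$. Put $$\epsilon_{approx}=\sup_{f\in\mathcal F}\inf_{q\in\mathcal P_w}KL(q\|p_f)\in[0,\infty].$$ **Theorem.** As $\eta\to0$ and $n\eta^{1/r}\to\infty$, $$KL(p^*\|p_{\tilde f})+KL(p_{\tilde f}\|p^*)=O_{p^*}\!\left(n^{-1}\eta^{-1/r}+\eta+\epsilon_{approx}\right),$$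 uniformly over the families $\mathcal P_w$ with the given bound $C_{\mathcal P}$ and over the saddle points. That is, for every $\delta>0$ there are $K<\infty$, $\eta_0>0$ and $M$ such that for all $n\ge1$ and $0<\eta\le\eta_0$ with $n\eta^{1/r}\ge M$ and all such $\mathcal P_w$, the set of samples for which some saddle point $(\tilde f,\tilde q)$ has $KL(p^*\|p_{\tilde f})+KL(p_{\tilde f}\|p^*)>K(n^{-1}\eta^{-1/r}+\eta+\epsilon_{approx})$ has (outer) probability at most $\delta$. Consequently, if $\eta\asymp n^{-r/(1+r)}$, then, in the same uniform sense as $n\to\infty$ (with constants that may also depend on those in $\asymp$), $$KL(p^*\|p_{\tilde f})+KL(p_{\tilde f}\|p^*)=O_{p^*}\!\left(n^{-r/(1+r)}+\epsilon_{approx}\right).$$ -/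

import Mathlib

open MeasureTheory Asymptotics Filter
open scoped ENNReal NNReal

namespace DoublyDual

noncomputable section

/-- The measure with (real-valued, nonnegative) density `q` with respect to `vol`. -/
def ofDensity {X : Type*} [MeasurableSpace X] (vol : Measure X) (q : X → ℝ) : Measure X :=
  vol.withDensity fun x => ENNReal.ofReal (q x)

/-- `q` is a probability density with respect to `vol`. -/
structure IsDensity {X : Type*} [MeasurableSpace X] (vol : Measure X) (q : X → ℝ) : Prop where
  measurable : Measurable q
  nonneg : ∀ x, 0 ≤ q x
  isProbabilityMeasure : IsProbabilityMeasure (ofDensity vol q)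

/-- The log-partition function `A(f) = log ∫ exp(f) dbase`, where `base = p₀ dx`. -/
def logPartition {X : Type*} [MeasurableSpace X] (base : Measure X) (f : X → ℝ) : ℝ :=
  Real.log (∫ x, Real.exp (f x) ∂base)

/-- The member `p_f = exp(f - A(f)) dbase` of the exponential family with base measure `base`. -/
def expFam {X : Type*} [MeasurableSpace X] (base : Measure X) (f : X → ℝ) : Measure X :=
  ofDensity base fun x => Real.exp (f x - logPartition base f)

/-- The scalar kernel `k(x, y)` of a reproducing kernel Hilbert space of real functions. -/
def kern (H : Type*) {X : Type*} [NormedAddCommGroup H] [InnerProductSpace ℝ H]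
    [CompleteSpace H] [RKHS ℝ H X ℝ] (x y : X) : ℝ :=
  RKHS.kernel H x y 1

/-- The span, in `L²(μ)`, of all eigenfunctions with eigenvalue at least `t` of the integral
operator `g ↦ ∫ k(·, y) g(y) dμ(y)`. -/
def eigenspan {X : Type*} [MeasurableSpace X] (k : X → X → ℝ) (μ : Measure X) (t : ℝ) :
    Submodule ℝ (Lp ℝ 2 μ) :=
  Submodule.span ℝ {g | ∃ s : ℝ, t ≤ s ∧ ∀ᵐ x ∂μ, ∫ y, k x y * g y ∂μ = s * g x}

/-- The eigenvalues of the kernel `k` with respect to `μ`, that is, the positive eigenvalues of the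
integral operator of `k` on `L²(μ)`, in nonincreasing order and repeated according to their
multiplicity; the indices start at `0`, and the value is `0` once the eigenvalues are exhausted. -/
def eigenvalue {X : Type*} [MeasurableSpace X] (k : X → X → ℝ) (μ : Measure X) (l : ℕ) : ℝ :=
  sSup {t : ℝ | 0 < t ∧ ((l + 1 : ℕ) : Cardinal) ≤ Module.rank ℝ (eigenspan k μ t)}

/-- The functions `ν` over which the Fenchel dual of `KL(q ‖ p₀)` is maximized: all measurable real
functions for which both expectations in the objective are finite. -/
def Admissible {X : Type*} [MeasurableSpace X] (vol : Measure X) (p₀ q ν : X → ℝ) : Prop :=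
  Measurable ν ∧ Integrable ν (ofDensity vol q) ∧
    Integrable (fun x => Real.exp (ν x)) (ofDensity vol p₀)

/-- The doubly dual objective
`ℓ(f, ν, q) = Ê_D[f] - E_q[f] - (η/2) ‖f‖² + E_q[ν] - E_{p₀}[exp ν]` for the sample `D`. -/
def objective {X H : Type*} [MeasurableSpace X] [NormedAddCommGroup H] [InnerProductSpace ℝ H]
    [RKHS ℝ H X ℝ] (vol : Measure X) (p₀ : X → ℝ) (η : ℝ) {n : ℕ} (D : Fin n → X)
    (f : H) (ν q : X → ℝ) : ℝ :=
  (n : ℝ)⁻¹ * ∑ i, f (D i) - ∫ x, f x ∂(ofDensity vol q) - η / 2 * ‖f‖ ^ 2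
    + (∫ x, ν x ∂(ofDensity vol q) - ∫ x, Real.exp (ν x) ∂(ofDensity vol p₀))

/-- The objective after the maximization over `ν`. -/
def value {X H : Type*} [MeasurableSpace X] [NormedAddCommGroup H] [InnerProductSpace ℝ H]
    [RKHS ℝ H X ℝ] (vol : Measure X) (p₀ : X → ℝ) (η : ℝ) {n : ℕ} (D : Fin n → X)
    (f : H) (q : X → ℝ) : EReal :=
  ⨆ (ν : X → ℝ) (_ : Admissible vol p₀ q ν), ((objective vol p₀ η D f ν q : ℝ) : EReal)

/-- `(f, q)` is an optimal primal-dual pair (saddle point) of `min_{q ∈ P} max_{f ∈ F, ν} ℓ`.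
The maximization over `ν` is the inner one and its maximizer need not be attained. -/
structure IsSaddle {X H : Type*} [MeasurableSpace X] [NormedAddCommGroup H]
    [InnerProductSpace ℝ H] [RKHS ℝ H X ℝ] (vol : Measure X) (p₀ : X → ℝ) (F : Set H)
    (P : Set (X → ℝ)) (η : ℝ) {n : ℕ} (D : Fin n → X) (f : H) (q : X → ℝ) : Prop where
  mem_primal : f ∈ F
  mem_dual : q ∈ P
  primal_optimal : ∀ g ∈ F, value vol p₀ η D g q ≤ value vol p₀ η D f q
  dual_optimal : ∀ q' ∈ P, value vol p₀ η D f q ≤ value vol p₀ η D f q'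

/-- The approximation error `sup_{f ∈ F} inf_{q ∈ P} KL(q ‖ p_f)`. -/
def approxError {X H : Type*} [MeasurableSpace X] [NormedAddCommGroup H]
    [InnerProductSpace ℝ H] [RKHS ℝ H X ℝ] (vol : Measure X) (p₀ : X → ℝ) (F : Set H)
    (P : Set (X → ℝ)) : ℝ≥0∞ :=
  ⨆ f ∈ F, ⨅ q ∈ P, InformationTheory.klDiv (ofDensity vol q) (expFam (ofDensity vol p₀) f)

/-- The symmetrized Kullback-Leibler divergence `KL(μ ‖ ν) + KL(ν ‖ μ)`. -/
def symmKL {X : Type*} [MeasurableSpace X] (μ ν : Measure X) : ℝ≥0∞ :=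
  InformationTheory.klDiv μ ν + InformationTheory.klDiv ν μ

/-- The samples of size `n` for which some saddle point estimate `p_f` of `p_{fstar}` has an error
exceeding `R`. -/
def badSamples {X H : Type*} [MeasurableSpace X] [NormedAddCommGroup H]
    [InnerProductSpace ℝ H] [RKHS ℝ H X ℝ] (vol : Measure X) (p₀ : X → ℝ) (F : Set H)
    (P : Set (X → ℝ)) (η : ℝ) (n : ℕ) (fstar : H) (R : ℝ≥0∞) : Set (Fin n → X) :=
  {D | ∃ (f : H) (q : X → ℝ), IsSaddle vol p₀ F P η D f q ∧
    R < symmKL (expFam (ofDensity vol p₀) fstar) (expFam (ofDensity vol p₀) f)}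

end

end DoublyDual

/-! Write `L` for the penalized log-likelihood. Maximizing over `ν` is the Donsker–Varadhan
principle: the value at `(f, q)` is at least `L f - 1`, by taking `ν = f - A(f)`, and at most `L f -
1 + KL(q ‖ p_f)`. Chaining these bounds through the two saddle inequalities shows that `f` maximizes
`L` over `F` up to the approximation error (`IsSaddle.penalizedLogLik_sub_le`).

Compare `f` with the truth and put `g = f - f*`, a function bounded by `G = 2 C_H √κ`. Since `p_f`
is `p*` tilted by `g`, both divergences are comparable with the variance of `g` under `p*`, with
constants depending on `G` only. Near-maximality then bounds a multiple of `Var g` by the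
approximation error, a penalty of order `η` and the fluctuation of the empirical mean of `g`.

The fluctuation is linear in `g`. In an eigenbasis of the covariance operator, Young's inequality
with weights `σ i + η` bounds it by a small multiple of `Var g + η ‖g‖²`, to be absorbed, plus a
multiple of a random `Z` that does not depend on `g`. The mean of `Z` is at most `n⁻¹ ∑ σ i / (σ i +
η)`, the effective dimension over `n`. Eigenvalue decay makes it `O(n⁻¹ η^(-1/r))`, and Markov's
inequality concludes (`exists_empiricalProcess_bound`). The decay passes from the integral operator
on `L²(p*)` to the covariance operator by counting eigenvalues above a level: centring lowers the
quadratic form, and eigenvectors in `H` are eigenfunctions in `L²(p*)`. -/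

namespace DoublyDual

/-! ### Spectral theory of compact symmetric operators. -/

section Hilbert

universe u

open Module.End

variable {E : Type u} [NormedAddCommGroup E] [InnerProductSpace ℝ E]

/-- An orthonormal family in a separable space is countable. -/
theorem _root_.Orthonormal.countable_of_separableSpace [TopologicalSpace.SeparableSpace E]
    {ι : Type*} {v : ι → E} (hv : Orthonormal ℝ v) : Countable ι := by
  have hd : ∀ i j, i ≠ j → 1 ≤ dist (v i) (v j) := by
    intro i j hij
    have h2 : ‖v i - v j‖ ^ 2 = 2 := by
      rw [@norm_sub_sq_real, hv.1 i, hv.1 j, hv.2 hij]; norm_num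
    rw [dist_eq_norm]
    nlinarith [norm_nonneg (v i - v j)]
  have := Set.PairwiseDisjoint.countable_of_isOpen (a := Set.univ)
    (s := fun i => Metric.ball (v i) (1 / 2)) ?_ (fun _ _ => Metric.isOpen_ball)
    (fun i _ => ⟨v i, Metric.mem_ball_self (by norm_num)⟩)
  · exact Set.countable_univ_iff.mp this
  · intro i _ j _ hij
    refine Metric.ball_disjoint_ball ?_
    have := hd i j hij
    linarith

/-- A compact symmetric operator on a Hilbert space has a Hilbert basis of eigenvectors. -/
theorem exists_hilbertBasis_eigenvectors [CompleteSpace E] {T : E →L[ℝ] E}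
    (hT : IsCompactOperator T) (hs : (T : E →ₗ[ℝ] E).IsSymmetric) :
    ∃ (ι : Type u) (b : HilbertBasis ι ℝ E) (l : ι → ℝ), ∀ i, T (b i) = l i • b i := by
  have hcl : ∀ μ : ℝ, IsClosed (eigenspace (T : E →ₗ[ℝ] E) μ : Set E) := by
    intro μ
    have : (eigenspace (T : E →ₗ[ℝ] E) μ : Set E) = {x | T x = μ • x} := by
      ext x; simp
    rw [this]
    exact isClosed_eq T.continuous (continuous_const_smul μ)
  have hc : ∀ μ : ℝ, CompleteSpace (eigenspace (T : E →ₗ[ℝ] E) μ) :=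
    fun μ => (hcl μ).completeSpace_coe
  choose w b hb using fun μ : ℝ => exists_hilbertBasis ℝ (eigenspace (T : E →ₗ[ℝ] E) μ)
  have ho := hs.orthogonalFamily_eigenspaces.orthonormal_sigma_orthonormal
    (v_family := fun μ => b μ) (fun μ => (b μ).orthonormal)
  refine ⟨Σ μ : ℝ, w μ, HilbertBasis.mkOfOrthogonalEqBot ho ?_,
    fun a : (Σ μ : ℝ, w μ) => a.1, ?_⟩
  · rw [Submodule.eq_bot_iff]
    intro x hx
    -- Orthogonality to a Hilbert basis of each eigenspace gives orthogonality to every eigenspace,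
    -- and the spectral theorem leaves only `0`.
    have key : x ∈ (⨆ μ, eigenspace (T : E →ₗ[ℝ] E) μ)ᗮ := by
      rw [← Submodule.iInf_orthogonal, Submodule.mem_iInf]
      intro μ
      rw [Submodule.mem_orthogonal]
      intro u hu
      have h1 := (b μ).hasSum_repr ⟨u, hu⟩
      have h2 := (h1.mapL (eigenspace (T : E →ₗ[ℝ] E) μ).subtypeL).mapL (innerSL ℝ x)
      have h3 : ∀ i, (innerSL ℝ x) ((eigenspace (T : E →ₗ[ℝ] E) μ).subtypeL
          ((b μ).repr ⟨u, hu⟩ i • (b μ) i)) = 0 := by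
        intro i
        have : inner ℝ x ((b μ i : eigenspace (T : E →ₗ[ℝ] E) μ) : E) = 0 := by
          rw [Submodule.mem_orthogonal'] at hx
          exact hx _ (Submodule.subset_span ⟨⟨μ, i⟩, rfl⟩)
        simp [this]
      simp_rw [h3] at h2
      have := h2.unique hasSum_zero
      rw [real_inner_comm]
      simpa using this
    rw [T.orthogonalComplement_iSup_eigenspaces_eq_bot hT hs] at key
    simpa using key
  · rintro ⟨μ, i⟩
    rw [HilbertBasis.coe_mkOfOrthogonalEqBot]
    have := (b μ i).2
    rw [mem_eigenspace_iff] at this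
    exact this

theorem hasSum_eigenvalue_mul_inner_sq {ι : Type*} (b : HilbertBasis ι ℝ E) {T : E →L[ℝ] E}
    (hs : (T : E →ₗ[ℝ] E).IsSymmetric) {l : ι → ℝ} (hb : ∀ i, T (b i) = l i • b i) (x : E) :
    HasSum (fun i => l i * inner ℝ (b i) x ^ 2) (inner ℝ (T x) x) := by
  have h := b.hasSum_inner_mul_inner (T x) x
  have e : ∀ i, inner ℝ (T x) (b i) * inner ℝ (b i) x = l i * inner ℝ (b i) x ^ 2 := by
    intro i
    have := hs x (b i)
    simp only [ContinuousLinearMap.coe_coe] at this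
    rw [this, hb, inner_smul_right, real_inner_comm]
    ring
  simpa only [e] using h

theorem hasSum_inner_sq {ι : Type*} (b : HilbertBasis ι ℝ E) (x : E) :
    HasSum (fun i => inner ℝ (b i) x ^ 2) (‖x‖ ^ 2) := by
  have h := b.hasSum_inner_mul_inner x x
  rw [real_inner_self_eq_norm_sq] at h
  have e : ∀ i, inner ℝ x (b i) * inner ℝ (b i) x = inner ℝ (b i) x ^ 2 := by
    intro i
    rw [real_inner_comm (b i) x]
    ring
  simpa only [e] using h

/-- The min-max principle, as a count of eigenvalues: if the quadratic form of `T` is at least `t`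
on the span of `m` orthonormal vectors, then at least `m` eigenvalues of `T` are at least `t`. -/
theorem exists_finset_le_eigenvalue {ι κ : Type*} (b : HilbertBasis ι ℝ E) {T : E →L[ℝ] E}
    (hs : (T : E →ₗ[ℝ] E).IsSymmetric) {l : ι → ℝ} (hb : ∀ i, T (b i) = l i • b i)
    {v : κ → E} (hv : Orthonormal ℝ v) (s : Finset κ) {t : ℝ}
    (ht : ∀ a : κ → ℝ, t * ‖∑ k ∈ s, a k • v k‖ ^ 2 ≤
      inner ℝ (T (∑ k ∈ s, a k • v k)) (∑ k ∈ s, a k • v k)) :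
    ∃ J : Finset ι, J.card = s.card ∧ ∀ i ∈ J, t ≤ l i := by
  classical
  by_contra! hcon
  have hfin : {i | t ≤ l i}.Finite := by
    by_contra hinf
    obtain ⟨J, hJ, hJc⟩ := Set.Infinite.exists_subset_card_eq hinf s.card
    obtain ⟨i, hi, hlt⟩ := hcon J hJc
    exact absurd (hJ hi) (not_le.mpr hlt)
  have hcard : hfin.toFinset.card < s.card := by
    by_contra! hle
    obtain ⟨J, hJ, hJc⟩ := Finset.exists_subset_card_eq hle
    obtain ⟨i, hi, hlt⟩ := hcon J hJc
    exact absurd (hfin.mem_toFinset.mp (hJ hi)) (not_le.mpr hlt)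
  let L : (s → ℝ) →ₗ[ℝ] E := Fintype.linearCombination ℝ (fun k : s => v k)
  let f : (s → ℝ) →ₗ[ℝ] (hfin.toFinset → ℝ) :=
    LinearMap.pi fun i => (innerₛₗ ℝ (b i)) ∘ₗ L
  -- There are fewer eigenvalues at or above `t` than free coefficients, so some nonzero combination
  -- of the `v k` is orthogonal to all their eigenvectors. There the form is strictly below `t
  -- ‖·‖²`, against `ht`.
  have hker : LinearMap.ker f ≠ ⊥ := by
    apply LinearMap.ker_ne_bot_of_finrank_lt
    simpa using hcard
  obtain ⟨a, ha, ha0⟩ := (Submodule.ne_bot_iff _).mp hker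
  have hL : L a = ∑ k ∈ s, (fun k => if h : k ∈ s then a ⟨k, h⟩ else 0) k • v k := by
    simp only [L, Fintype.linearCombination_apply]
    rw [← Finset.sum_coe_sort s]
    simp
  have hLne : L a ≠ 0 := by
    intro h0
    apply ha0
    have hli : LinearIndependent ℝ (fun k : s => v k) :=
      hv.linearIndependent.comp _ Subtype.val_injective
    ext k
    exact Fintype.linearIndependent_iff.mp hli a (by
      simpa [L, Fintype.linearCombination_apply] using h0) k
  have hle := ht (fun k => if h : k ∈ s then a ⟨k, h⟩ else 0)
  rw [← hL] at hle
  have hz : ∀ i, t ≤ l i → inner ℝ (b i) (L a) = 0 := by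
    intro i hi
    have := congrFun (LinearMap.mem_ker.mp ha) ⟨i, hfin.mem_toFinset.mpr hi⟩
    simpa [f] using this
  have h1 := hasSum_eigenvalue_mul_inner_sq b hs hb (L a)
  have h2 := (hasSum_inner_sq b (L a)).mul_left t
  have hex : ∃ i, inner ℝ (b i) (L a) ≠ 0 := by
    by_contra! h0
    have h3 := hasSum_inner_sq b (L a)
    simp_rw [h0] at h3
    have : ‖L a‖ ^ 2 = 0 := h3.unique (by simp)
    exact hLne (by simpa using this)
  obtain ⟨i, hi⟩ := hex
  have hlt : inner ℝ (T (L a)) (L a) < t * ‖L a‖ ^ 2 := by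
    refine hasSum_lt (i := i) ?_ ?_ h1 h2
    · intro j
      by_cases hj : t ≤ l j
      · simp [hz j hj]
      · exact mul_le_mul_of_nonneg_right (not_le.mp hj).le (sq_nonneg _)
    · have : ¬ t ≤ l i := fun h => hi (hz i h)
      exact mul_lt_mul_of_pos_right (not_le.mp this) (by positivity)
  linarith

end Hilbert

/-! ### The feature map: bounds and measurability. -/

section Features

variable {X H : Type*} [NormedAddCommGroup H] [InnerProductSpace ℝ H]
  [CompleteSpace H] [RKHS ℝ H X ℝ]

variable (H) in
/-- The canonical feature map `x ↦ k(·, x)` of a reproducing kernel Hilbert space. -/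
noncomputable def feature (x : X) : H := RKHS.kerFun H x 1

@[simp]
theorem inner_feature_right (f : H) (x : X) : inner ℝ f (feature H x) = f x := by
  simp [feature]

@[simp]
theorem inner_feature_left (f : H) (x : X) : inner ℝ (feature H x) f = f x := by
  rw [real_inner_comm, inner_feature_right]

theorem feature_apply (x y : X) : feature H y x = kern H x y := by
  simp [feature, kern, RKHS.kerFun_apply]

theorem norm_feature_sq (x : X) : ‖feature H x‖ ^ 2 = kern H x x := by
  rw [← real_inner_self_eq_norm_sq, inner_feature_right, feature_apply]

theorem norm_feature_le {κ : ℝ} (hk : ∀ x y : X, kern H x y ≤ κ) (x : X) :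
    ‖feature H x‖ ≤ √κ :=
  Real.le_sqrt_of_sq_le ((norm_feature_sq x).trans_le (hk x x))

theorem abs_apply_le {κ : ℝ} (hk : ∀ x y : X, kern H x y ≤ κ) (f : H) (x : X) :
    |f x| ≤ ‖f‖ * √κ := by
  rw [← inner_feature_right]
  exact (abs_real_inner_le_norm _ _).trans
    (mul_le_mul_of_nonneg_left (norm_feature_le hk x) (norm_nonneg _))

variable [MeasurableSpace X]

/-- Kernel sections are measurable and span a dense subspace, and convergence in `H` implies
pointwise convergence. -/
theorem measurable_apply (hk_meas : Measurable (Function.uncurry (kern H (X := X)))) (f : H) :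
    Measurable f := by
  have hf : f ∈ (Submodule.span ℝ {RKHS.kerFun H x v | (x) (v)}).topologicalClosure := by
    rw [RKHS.kerFun_dense H]; trivial
  have hspan : ∀ g ∈ Submodule.span ℝ {RKHS.kerFun H x v | (x : X) (v : ℝ)},
      Measurable (g : X → ℝ) := by
    intro g hg
    induction hg using Submodule.span_induction with
    | mem g hg =>
      obtain ⟨x, v, rfl⟩ := hg
      have : (RKHS.kerFun H x v : X → ℝ) = fun y => v * kern H y x := by
        ext y
        have hv : RKHS.kerFun H x v = v • feature H x := by
          rw [feature, ← map_smul]; simp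
        rw [hv, RKHS.coe_smul, Pi.smul_apply, feature_apply, smul_eq_mul]
      rw [this]
      exact (hk_meas.comp (measurable_id.prodMk measurable_const)).const_mul v
    | zero => rw [RKHS.coe_zero]; exact measurable_zero
    | add g h _ _ hg hh => rw [RKHS.coe_add]; exact hg.add hh
    | smul c g _ hg => rw [RKHS.coe_smul]; exact hg.const_smul c
  rw [← SetLike.mem_coe, Submodule.topologicalClosure_coe, mem_closure_iff_seq_limit] at hf
  obtain ⟨u, hu, hlim⟩ := hf
  refine measurable_of_tendsto_metrizable (fun n => hspan (u n) (hu n)) ?_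
  rw [tendsto_pi_nhds]
  intro x
  exact ((RKHS.continuous_eval (H := H) x).tendsto f).comp hlim

theorem memLp_apply {μ : Measure X} {κ : ℝ} [IsFiniteMeasure μ] (hk : ∀ x y : X, kern H x y ≤ κ)
    (hk_meas : Measurable (Function.uncurry (kern H (X := X)))) (f : H) (p : ℝ≥0∞) :
    MemLp f p μ :=
  MemLp.of_bound (measurable_apply hk_meas f).aestronglyMeasurable (‖f‖ * √κ)
    (ae_of_all _ (abs_apply_le hk f))

/-- The distance from `feature H x` to a fixed `c` expands into kernel and point values, so
preimages of balls are measurable; separability writes each open set as a countable union of balls.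
-/
theorem stronglyMeasurable_feature [TopologicalSpace.SeparableSpace H]
    (hk_meas : Measurable (Function.uncurry (kern H (X := X)))) :
    StronglyMeasurable (feature H (X := X)) := by
  borelize H
  have hball : ∀ (c : H) (r : ℝ), MeasurableSet (feature H (X := X) ⁻¹' Metric.ball c r) := by
    intro c r
    have hd : Measurable fun x : X => dist (feature H x) c := by
      have : (fun x : X => dist (feature H x) c) =
          fun x => √(kern H x x - 2 * c x + ‖c‖ ^ 2) := by
        ext x
        rw [dist_eq_norm, ← Real.sqrt_sq (norm_nonneg _), @norm_sub_sq_real, norm_feature_sq,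
          inner_feature_left]
      rw [this]
      exact (((hk_meas.comp (measurable_id.prodMk measurable_id)).sub
        ((measurable_apply hk_meas c).const_mul 2)).add_const _).sqrt
    exact hd measurableSet_Iio
  have hm : Measurable (feature H (X := X)) := by
    refine measurable_of_isOpen fun s hs => ?_
    choose! ρ hρ using fun x (hx : x ∈ s) => Metric.isOpen_iff.mp hs x hx
    obtain ⟨T, hT, hTs⟩ := TopologicalSpace.isOpen_iUnion_countable
      (fun x : s => Metric.ball (x : H) (ρ x)) (fun _ => Metric.isOpen_ball)
    have hs' : s = ⋃ x ∈ T, Metric.ball (x : H) (ρ x) := by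
      rw [hTs]
      apply Set.Subset.antisymm
      · intro x hx
        exact Set.mem_iUnion.mpr ⟨⟨x, hx⟩, Metric.mem_ball_self (hρ x hx).1⟩
      · exact Set.iUnion_subset fun x => (hρ x x.2).2
    rw [hs']
    simp only [Set.preimage_iUnion]
    exact MeasurableSet.biUnion hT fun x _ => hball _ _
  exact hm.stronglyMeasurable

end Features

/-! ### Moment and covariance operators on `H`. -/

section Covariance

variable {X H : Type*} [MeasurableSpace X] [NormedAddCommGroup H] [InnerProductSpace ℝ H]
  [CompleteSpace H] [RKHS ℝ H X ℝ]

variable (H) in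
/-- The mean embedding of `μ`. -/
noncomputable def meanFeature (μ : Measure X) : H := ∫ x, feature H x ∂μ

variable (H) in
/-- The uncentred covariance operator `∫ k(·, x) ⊗ k(·, x) dμ(x)`. -/
noncomputable def momentOp (μ : Measure X) : H →L[ℝ] H :=
  ∫ x, InnerProductSpace.rankOne ℝ (feature H x) (feature H x) ∂μ

variable (H) in
/-- The covariance operator of the feature map. -/
noncomputable def covOp (μ : Measure X) : H →L[ℝ] H :=
  momentOp H μ - InnerProductSpace.rankOne ℝ (meanFeature H μ) (meanFeature H μ)

variable [TopologicalSpace.SeparableSpace H] {μ : Measure X} {κ : ℝ}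

theorem integrable_feature [IsFiniteMeasure μ] (hk : ∀ x y : X, kern H x y ≤ κ)
    (hk_meas : Measurable (Function.uncurry (kern H (X := X)))) :
    Integrable (feature H (X := X)) μ :=
  Integrable.of_bound (stronglyMeasurable_feature hk_meas).aestronglyMeasurable (√κ)
    (ae_of_all _ (norm_feature_le hk))

theorem integrable_rankOne_feature [IsFiniteMeasure μ] (hk : ∀ x y : X, kern H x y ≤ κ)
    (hk_meas : Measurable (Function.uncurry (kern H (X := X)))) :
    Integrable (fun x : X => InnerProductSpace.rankOne ℝ (feature H x) (feature H x)) μ := by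
  refine Integrable.of_bound (C := √κ * √κ) ?_ (ae_of_all _ fun x => ?_)
  · have hc : Continuous fun h : H => InnerProductSpace.rankOne ℝ h h :=
      (InnerProductSpace.rankOne ℝ (E := H) (F := H)).continuous₂.comp
        (continuous_id.prodMk continuous_id)
    exact (hc.comp_stronglyMeasurable (stronglyMeasurable_feature hk_meas)).aestronglyMeasurable
  · rw [InnerProductSpace.norm_rankOne]
    exact mul_self_le_mul_self (norm_nonneg _) (norm_feature_le hk x)

theorem inner_meanFeature [IsFiniteMeasure μ] (hk : ∀ x y : X, kern H x y ≤ κ)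
    (hk_meas : Measurable (Function.uncurry (kern H (X := X)))) (f : H) :
    inner ℝ f (meanFeature H μ) = ∫ x, f x ∂μ := by
  rw [meanFeature, ← integral_inner (integrable_feature hk hk_meas)]
  simp

theorem momentOp_apply [IsFiniteMeasure μ] (hk : ∀ x y : X, kern H x y ≤ κ)
    (hk_meas : Measurable (Function.uncurry (kern H (X := X)))) (f : H) :
    momentOp H μ f = ∫ x, f x • feature H x ∂μ := by
  rw [momentOp, ContinuousLinearMap.integral_apply (integrable_rankOne_feature hk hk_meas)]
  simp

theorem inner_momentOp [IsFiniteMeasure μ] (hk : ∀ x y : X, kern H x y ≤ κ)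
    (hk_meas : Measurable (Function.uncurry (kern H (X := X)))) (f g : H) :
    inner ℝ (momentOp H μ f) g = ∫ x, f x * g x ∂μ := by
  have hi : Integrable (fun x : X => f x • feature H x) μ := by
    have := (integrable_rankOne_feature hk hk_meas (μ := μ)).apply_continuousLinearMap f
    simpa using this
  rw [momentOp_apply hk hk_meas, real_inner_comm, ← integral_inner hi]
  simp [inner_smul_right]

theorem isSymmetric_momentOp [IsFiniteMeasure μ] (hk : ∀ x y : X, kern H x y ≤ κ)
    (hk_meas : Measurable (Function.uncurry (kern H (X := X)))) :
    (momentOp H μ : H →ₗ[ℝ] H).IsSymmetric := by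
  intro f g
  simp only [ContinuousLinearMap.coe_coe]
  rw [real_inner_comm _ f, inner_momentOp hk hk_meas, inner_momentOp hk hk_meas]
  simp_rw [mul_comm]

omit [CompleteSpace H] [RKHS ℝ H X ℝ] [TopologicalSpace.SeparableSpace H] in
theorem isCompactOperator_rankOne (x y : H) :
    IsCompactOperator (InnerProductSpace.rankOne ℝ x y : H →L[ℝ] H) := by
  have h : IsCompactOperator (ContinuousLinearMap.toSpanSingleton ℝ x : ℝ →L[ℝ] H) :=
    ⟨_, (isCompact_closedBall (0 : ℝ) 1).image (ContinuousLinearMap.continuous _),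
      Filter.mem_of_superset (Metric.closedBall_mem_nhds 0 one_pos) (Set.subset_preimage_image _ _)⟩
  rw [InnerProductSpace.rankOne_def']
  exact h.comp_clm (innerSL ℝ y)

/-- Compact operators form a closed convex set, so an average of rank one operators stays in it. -/
theorem isCompactOperator_momentOp [IsProbabilityMeasure μ] (hk : ∀ x y : X, kern H x y ≤ κ)
    (hk_meas : Measurable (Function.uncurry (kern H (X := X)))) :
    IsCompactOperator (momentOp H μ) := by
  have hc := (compactOperator (RingHom.id ℝ) H H).convex
  exact hc.integral_mem isClosed_setOfPred_isCompactOperator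
    (ae_of_all _ fun x => isCompactOperator_rankOne _ _) (integrable_rankOne_feature hk hk_meas)

theorem isCompactOperator_covOp [IsProbabilityMeasure μ] (hk : ∀ x y : X, kern H x y ≤ κ)
    (hk_meas : Measurable (Function.uncurry (kern H (X := X)))) :
    IsCompactOperator (covOp H μ) :=
  (isCompactOperator_momentOp hk hk_meas).sub (isCompactOperator_rankOne _ _)

theorem isSymmetric_covOp [IsFiniteMeasure μ] (hk : ∀ x y : X, kern H x y ≤ κ)
    (hk_meas : Measurable (Function.uncurry (kern H (X := X)))) :
    (covOp H μ : H →ₗ[ℝ] H).IsSymmetric := by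
  have := (isSymmetric_momentOp hk hk_meas (μ := μ)).sub
    (InnerProductSpace.isSymmetric_rankOne_self (𝕜 := ℝ) (meanFeature H μ))
  simpa [covOp] using this

theorem inner_covOp_self [IsProbabilityMeasure μ] (hk : ∀ x y : X, kern H x y ≤ κ)
    (hk_meas : Measurable (Function.uncurry (kern H (X := X)))) (f : H) :
    inner ℝ (covOp H μ f) f = ProbabilityTheory.variance f μ := by
  rw [ProbabilityTheory.variance_eq_sub (memLp_apply hk hk_meas f 2), covOp,
    _root_.sub_apply, inner_sub_left, inner_momentOp hk hk_meas,
    InnerProductSpace.rankOne_apply, inner_smul_left, real_inner_comm _ (meanFeature H μ),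
    inner_meanFeature hk hk_meas]
  simp [pow_two]

/-- The two forms differ by the square of the mean. This links the variance, which governs
fluctuations, to the uncentred operator, whose spectrum is assumed to decay. -/
theorem inner_covOp_le [IsProbabilityMeasure μ] (hk : ∀ x y : X, kern H x y ≤ κ)
    (hk_meas : Measurable (Function.uncurry (kern H (X := X)))) (f : H) :
    inner ℝ (covOp H μ f) f ≤ inner ℝ (momentOp H μ f) f := by
  rw [inner_covOp_self hk hk_meas, inner_momentOp hk hk_meas,
    ProbabilityTheory.variance_eq_sub (memLp_apply hk hk_meas f 2)]
  simp only [Pi.pow_apply, pow_two, tsub_le_iff_right, le_add_iff_nonneg_right]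
  exact mul_self_nonneg _

end Covariance

/-! ### From eigenvalues on `L²(μ)` to eigenvalues of the covariance operator. -/

section Counting

variable {X H : Type*} [NormedAddCommGroup H] [InnerProductSpace ℝ H]
  [CompleteSpace H] [RKHS ℝ H X ℝ]

theorem kern_comm (x y : X) : kern H x y = kern H y x := by
  rw [← feature_apply, ← inner_feature_right, real_inner_comm, inner_feature_right, feature_apply]

theorem abs_kern_le {κ : ℝ} (hk : ∀ x y : X, kern H x y ≤ κ) (x y : X) :
    |kern H x y| ≤ √κ * √κ := by
  rw [← feature_apply]
  exact (abs_apply_le hk _ x).trans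
    (mul_le_mul_of_nonneg_right (norm_feature_le hk y) (Real.sqrt_nonneg _))

variable [MeasurableSpace X] {μ : Measure X} {κ : ℝ}

/-- An integral operator with a bounded kernel has bounded eigenvalues. -/
theorem le_of_eigenfunction [IsProbabilityMeasure μ] {k : X → X → ℝ} {B : ℝ}
    (hk : ∀ x y, |k x y| ≤ B) {g : Lp ℝ 2 μ} (hg : g ≠ 0) {s : ℝ}
    (hs : ∀ᵐ x ∂μ, ∫ y, k x y * g y ∂μ = s * g x) : s ≤ B := by
  have hgi : Integrable g μ := (Lp.memLp g).integrable (by norm_num)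
  have hpos : 0 < ∫ x, |g x| ∂μ := by
    rw [integral_pos_iff_support_of_nonneg (fun _ => abs_nonneg _) hgi.abs]
    rw [pos_iff_ne_zero]
    intro h0
    apply hg
    rw [Lp.eq_zero_iff_ae_eq_zero]
    have : ∀ᵐ x ∂μ, x ∉ Function.support fun x => |g x| := measure_eq_zero_iff_ae_notMem.mp h0
    filter_upwards [this] with x hx
    simpa using hx
  -- Integrating this pointwise bound over the probability measure leaves the `L¹` norm of `g` on
  -- both sides.
  have hx : ∀ᵐ x ∂μ, s * |g x| ≤ B * ∫ y, |g y| ∂μ := by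
    filter_upwards [hs] with x hx
    calc s * |g x| ≤ |s| * |g x| := mul_le_mul_of_nonneg_right (le_abs_self s) (abs_nonneg _)
      _ = |∫ y, k x y * g y ∂μ| := by rw [hx, abs_mul]
      _ ≤ ∫ y, B * |g y| ∂μ := by
          refine norm_integral_le_of_norm_le (f := fun y => k x y * g y) (hgi.abs.const_mul B) ?_
          refine ae_of_all _ fun y => ?_
          rw [Real.norm_eq_abs, abs_mul]
          exact mul_le_mul_of_nonneg_right (hk x y) (abs_nonneg _)
      _ = B * ∫ y, |g y| ∂μ := integral_const_mul _ _
  have hint := integral_mono_ae (hgi.abs.const_mul s) (integrable_const _) hx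
  rw [integral_const_mul, integral_const] at hint
  simp only [probReal_univ, smul_eq_mul, one_mul] at hint
  exact le_of_mul_le_mul_right hint hpos

/-- The real `sSup` is meaningful only for a set bounded above; a bounded kernel ensures this, as
every level with nonzero eigenspan is at most `B`. -/
theorem le_eigenvalue_of_le_rank [IsProbabilityMeasure μ] {k : X → X → ℝ} {B : ℝ}
    (hk : ∀ x y, |k x y| ≤ B) {l : ℕ} {t : ℝ} (ht : 0 < t)
    (hr : ((l + 1 : ℕ) : Cardinal) ≤ Module.rank ℝ (eigenspan k μ t)) :
    t ≤ eigenvalue k μ l := by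
  refine le_csSup ⟨B, ?_⟩ ⟨ht, hr⟩
  rintro u ⟨hu, hur⟩
  have hne : eigenspan k μ u ≠ ⊥ := by
    intro h
    rw [h, rank_bot] at hur
    simp at hur
  have : ∃ g ∈ {g : Lp ℝ 2 μ | ∃ s : ℝ, u ≤ s ∧ ∀ᵐ x ∂μ, ∫ y, k x y * g y ∂μ = s * g x},
      g ≠ 0 := by
    by_contra! h
    exact hne (Submodule.span_eq_bot.mpr h)
  obtain ⟨g, ⟨s, hus, hs⟩, hg⟩ := this
  exact hus.trans (le_of_eigenfunction hk hg hs)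

/-- Eigenvectors of the moment operator in `H` give eigenfunctions of the integral operator
in `L²(μ)`. -/
theorem card_le_rank_eigenspan [TopologicalSpace.SeparableSpace H] [IsProbabilityMeasure μ]
    (hk : ∀ x y : X, kern H x y ≤ κ)
    (hk_meas : Measurable (Function.uncurry (kern H (X := X))))
    {ι : Type*} {b : ι → H} (hb : Orthonormal ℝ b) {l : ι → ℝ}
    (hl : ∀ i, momentOp H μ (b i) = l i • b i) {t : ℝ} (ht : 0 < t) (J : Finset ι)
    (hJ : ∀ i ∈ J, t ≤ l i) :
    (J.card : Cardinal) ≤ Module.rank ℝ (eigenspan (kern H) μ t) := by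
  let e : J → Lp ℝ 2 μ := fun i => (memLp_apply (μ := μ) hk hk_meas (b i) 2).toLp
  have hecoe : ∀ i, e i =ᵐ[μ] (b i : X → ℝ) := fun i => MemLp.coeFn_toLp _
  -- The `L²` inner product is the form of `momentOp`, so the classes `e i` are orthogonal, and
  -- nonzero because `l i ≥ t > 0`.
  have hinner : ∀ i j, inner ℝ (e i) (e j) = l i * inner ℝ (b i) (b j) := by
    intro i j
    have h1 : l i * inner ℝ (b i) (b j) = inner ℝ (momentOp H μ (b i)) (b j) := by
      rw [hl, real_inner_smul_left]
    rw [h1, inner_momentOp hk hk_meas, L2.inner_def]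
    refine integral_congr_ae ?_
    filter_upwards [hecoe i, hecoe j] with x hi hj
    simp [hi, hj, mul_comm]
  have hli : LinearIndependent ℝ e := by
    refine linearIndependent_of_ne_zero_of_inner_eq_zero (𝕜 := ℝ) ?_ ?_
    · intro i h0
      have := hinner i i
      rw [h0, inner_zero_left, real_inner_self_eq_norm_sq, hb.1] at this
      have := hJ i i.2
      linarith
    · intro i j hij
      change inner ℝ (e i) (e j) = 0
      rw [hinner, hb.2 (Subtype.coe_injective.ne hij), mul_zero]
  have hmem : ∀ i, e i ∈ eigenspan (kern H) μ t := by
    intro i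
    refine Submodule.subset_span ⟨l i, hJ i i.2, ?_⟩
    filter_upwards [hecoe i] with x hx
    rw [hx]
    have h1 : ∫ y, kern H x y * e i y ∂μ = ∫ y, (b i) y * feature H x y ∂μ := by
      refine integral_congr_ae ?_
      filter_upwards [hecoe i] with y hy
      rw [hy, feature_apply, kern_comm, mul_comm]
    rw [h1, ← inner_momentOp hk hk_meas, hl, inner_feature_right, RKHS.coe_smul]
    rfl
  have hli' : LinearIndependent ℝ
      (fun i => (⟨e i, hmem i⟩ : eigenspan (kern H) μ t)) :=
    LinearIndependent.of_comp (eigenspan (kern H) μ t).subtype hli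
  have := hli'.cardinal_lift_le_rank
  simpa using this

/-- Counting the large eigenvalues of the covariance operator. -/
theorem le_eigenvalue_of_covOp [TopologicalSpace.SeparableSpace H] [IsProbabilityMeasure μ]
    (hk : ∀ x y : X, kern H x y ≤ κ)
    (hk_meas : Measurable (Function.uncurry (kern H (X := X))))
    {ι : Type*} {b : ι → H} (hb : Orthonormal ℝ b) {l : ι → ℝ}
    (hl : ∀ i, covOp H μ (b i) = l i • b i) {t : ℝ} (ht : 0 < t) (s : Finset ι) {m : ℕ}
    (hm : s.card = m + 1) (hs : ∀ i ∈ s, t ≤ l i) :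
    t ≤ eigenvalue (kern H) μ m := by
  obtain ⟨ι', c, lam, hc⟩ := exists_hilbertBasis_eigenvectors
    (isCompactOperator_momentOp (μ := μ) hk hk_meas) (isSymmetric_momentOp hk hk_meas)
  -- On the span of the chosen eigenvectors the covariance form is at least `t ‖·‖²`, and the moment
  -- form dominates it.
  obtain ⟨J, hJ, hJt⟩ := exists_finset_le_eigenvalue c (isSymmetric_momentOp (μ := μ) hk hk_meas)
    hc hb s (t := t) (fun a => by
      refine le_trans ?_ (inner_covOp_le hk hk_meas _)
      rw [map_sum, ← real_inner_self_eq_norm_sq]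
      have e : ∀ i, covOp H μ (a i • b i) = (a i * l i) • b i := fun i => by
        rw [map_smul, hl, smul_smul]
      simp_rw [e]
      rw [hb.inner_sum, hb.inner_sum, Finset.mul_sum]
      refine Finset.sum_le_sum fun i hi => ?_
      have := mul_le_mul_of_nonneg_right (hs i hi) (mul_self_nonneg (a i))
      simp only [conj_trivial]
      linarith)
  refine le_eigenvalue_of_le_rank (abs_kern_le hk) ht ?_
  rw [← hm, ← hJ]
  exact card_le_rank_eigenspan hk hk_meas c.orthonormal hc ht J hJt

end Counting

/-! ### Effective dimension under polynomial decay. -/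

section EffectiveDimension

/-- The layer cake bound for a sum of truncated numbers. -/
theorem sum_min_le_of_card_le {ι : Type*} (s : Finset ι) {σ : ι → ℝ} (hσ : ∀ i, 0 ≤ σ i)
    {A p η : ℝ} (hp : p < 1) (hη : 0 < η)
    (hN : ∀ t, 0 < t → ((s.filter fun i => t ≤ σ i).card : ℝ) ≤ A * t ^ (-p)) :
    ∑ i ∈ s, min (σ i) η ≤ A * (η ^ (1 - p) / (1 - p)) := by
  have hi : ∀ i, IntervalIntegrable (Set.indicator (Set.Iic (σ i)) fun _ => (1 : ℝ)) volume 0 η :=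
    fun i => ⟨intervalIntegrable_const.1.indicator measurableSet_Iic,
      intervalIntegrable_const.2.indicator measurableSet_Iic⟩
  -- Summing these integrals over `i` turns the integrand into the number of `σ i` that are at least
  -- `t`.
  have h1 : ∀ i, min (σ i) η =
      ∫ t in (0 : ℝ)..η, Set.indicator (Set.Iic (σ i)) (fun _ => (1 : ℝ)) t := by
    intro i
    rw [intervalIntegral.integral_of_le hη.le, setIntegral_indicator measurableSet_Iic,
      Set.Ioc_inter_Iic, setIntegral_const]
    simp [hσ i, hη.le, min_comm]
  simp_rw [h1]
  rw [← intervalIntegral.integral_finsetSum fun i _ => hi i]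
  have h2 : ∫ t in (0 : ℝ)..η, A * t ^ (-p) = A * (η ^ (1 - p) / (1 - p)) := by
    rw [intervalIntegral.integral_const_mul, integral_rpow (Or.inl (by linarith))]
    rw [show -p + 1 = 1 - p by ring, Real.zero_rpow (by linarith), sub_zero]
  rw [← h2]
  refine intervalIntegral.integral_mono_on_of_le_Ioo hη.le ?_ ?_ ?_
  · have := IntervalIntegrable.sum s fun i _ => hi i
    rwa [Finset.sum_fn] at this
  · exact (intervalIntegral.intervalIntegrable_rpow' (by linarith)).const_mul A
  · intro t ht
    refine le_trans (le_of_eq ?_) (hN t ht.1)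
    simp [Set.indicator_apply]

/-- The comparison sequence never vanishes, so one constant serves all indices, not only large ones.
-/
theorem exists_eigenvalue_le {X : Type*} [MeasurableSpace X] {k : X → X → ℝ} {μ : Measure X}
    {r : ℝ} (h : (fun l : ℕ => eigenvalue k μ l) =O[atTop] fun l : ℕ => ((l : ℝ) + 1) ^ (-r)) :
    ∃ B, 0 < B ∧ ∀ l : ℕ, eigenvalue k μ l ≤ B * ((l : ℝ) + 1) ^ (-r) := by
  obtain ⟨B, hB, hb⟩ := bound_of_isBigO_nat_atTop h
  refine ⟨B, hB, fun l => ?_⟩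
  have hpos : (0 : ℝ) < ((l : ℝ) + 1) ^ (-r) := by positivity
  have := hb (x := l) hpos.ne'
  rw [Real.norm_of_nonneg hpos.le] at this
  exact (le_abs_self _).trans this

variable {X H : Type*} [NormedAddCommGroup H] [InnerProductSpace ℝ H]
  [CompleteSpace H] [RKHS ℝ H X ℝ] [MeasurableSpace X] {μ : Measure X} {κ : ℝ}

/-- Polynomial decay of the eigenvalues of the kernel bounds the effective dimension. -/
theorem sum_min_eigenvalue_le [TopologicalSpace.SeparableSpace H] [IsProbabilityMeasure μ]
    (hk : ∀ x y : X, kern H x y ≤ κ)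
    (hk_meas : Measurable (Function.uncurry (kern H (X := X))))
    {B r : ℝ} (hB : 0 < B) (hr : 1 < r)
    (hdecay : ∀ l : ℕ, eigenvalue (kern H) μ l ≤ B * ((l : ℝ) + 1) ^ (-r))
    {ι : Type*} {b : ι → H} (hb : Orthonormal ℝ b) {σ : ι → ℝ} (hσ : ∀ i, 0 ≤ σ i)
    (hl : ∀ i, covOp H μ (b i) = σ i • b i) {η : ℝ} (hη : 0 < η) (s : Finset ι) :
    ∑ i ∈ s, min (σ i) η ≤ B ^ (1 / r) * (η ^ (1 - 1 / r) / (1 - 1 / r)) := by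
  have hr0 : 0 < r := by linarith
  refine sum_min_le_of_card_le s hσ ((div_lt_one hr0).mpr hr) hη fun t ht => ?_
  rcases Nat.eq_zero_or_pos (s.filter fun i => t ≤ σ i).card with h0 | h0
  · rw [h0]; simp only [Nat.cast_zero]; positivity
  obtain ⟨m, hm⟩ := Nat.exists_eq_add_of_lt h0
  rw [zero_add] at hm
  have h1 := (le_eigenvalue_of_covOp hk hk_meas hb hl ht _ hm
    fun i hi => (Finset.mem_filter.mp hi).2).trans (hdecay m)
  rw [hm]
  push_cast
  set M : ℝ := (m : ℝ) + 1 with hM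
  have hMpos : 0 < M := by positivity
  -- With indices starting at `0`, a count of `m + 1` bounds `t` by the eigenvalue of index `m`;
  -- solving for the count gives `M ≤ (B / t)^(1/r)`.
  have h2 : M ^ r ≤ B / t := by
    rw [le_div_iff₀ ht]
    rw [Real.rpow_neg hMpos.le, ← div_eq_mul_inv, le_div_iff₀ (by positivity)] at h1
    linarith
  have h3 := Real.rpow_le_rpow (by positivity) h2 (by positivity : 0 ≤ 1 / r)
  rw [← Real.rpow_mul hMpos.le, mul_one_div_cancel hr0.ne', Real.rpow_one,
    Real.div_rpow hB.le ht.le] at h3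
  rwa [Real.rpow_neg ht.le, ← div_eq_mul_inv]

end EffectiveDimension

/-! ### Localized control of the empirical process. -/

section Empirical

open ProbabilityTheory

/-- The mean squared error of an empirical mean. -/
theorem lintegral_empiricalMean_sub_sq {X : Type*} [MeasurableSpace X] {μ : Measure X}
    [IsProbabilityMeasure μ] {f : X → ℝ} (hf : MemLp f 2 μ) {n : ℕ} (hn : 0 < n) :
    ∫⁻ D, ENNReal.ofReal (((n : ℝ)⁻¹ * ∑ j, f (D j) - ∫ x, f x ∂μ) ^ 2)
      ∂(Measure.pi fun _ : Fin n => μ) = ENNReal.ofReal ((n : ℝ)⁻¹ * Var[f; μ]) := by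
  have hn' : (n : ℝ) ≠ 0 := by positivity
  have hcomp : ∀ j : Fin n, MemLp (fun D : Fin n → X => f (D j)) 2 (Measure.pi fun _ => μ) :=
    fun j => hf.comp_measurePreserving (measurePreserving_eval (fun _ : Fin n => μ) j)
  have hsum : MemLp (fun D : Fin n → X => (n : ℝ)⁻¹ * ∑ j, f (D j)) 2 (Measure.pi fun _ => μ) :=
    (memLp_finsetSum _ fun j _ => hcomp j).const_mul _
  have hmean : ∫ D : Fin n → X, (n : ℝ)⁻¹ * ∑ j, f (D j) ∂(Measure.pi fun _ => μ)
      = ∫ x, f x ∂μ := by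
    rw [integral_const_mul, integral_finsetSum _ fun j _ => (hcomp j).integrable (by norm_num)]
    have : ∀ j : Fin n, ∫ D : Fin n → X, f (D j) ∂(Measure.pi fun _ => μ) = ∫ x, f x ∂μ :=
      fun j => integral_comp_eval (μ := fun _ : Fin n => μ) (i := j) hf.aestronglyMeasurable
    simp_rw [this]
    simp [hn']
  have hvar : Var[fun D : Fin n → X => (n : ℝ)⁻¹ * ∑ j, f (D j); Measure.pi fun _ => μ]
      = (n : ℝ)⁻¹ * Var[f; μ] := by
    rw [variance_const_mul]
    have := variance_sum_pi (μ := fun _ : Fin n => μ) (X := fun _ => f) fun _ => hf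
    rw [Finset.sum_fn] at this
    rw [this]
    simp
    field_simp
  rw [← hvar, variance_eq_integral hsum.aestronglyMeasurable.aemeasurable, hmean,
    ofReal_integral_eq_lintegral_ofReal]
  · exact (hsum.sub (memLp_const _)).integrable_sq
  · exact ae_of_all _ fun _ => sq_nonneg _

variable {X H : Type*} [NormedAddCommGroup H] [InnerProductSpace ℝ H]
  [CompleteSpace H] [RKHS ℝ H X ℝ] [MeasurableSpace X] {μ : Measure X} {κ : ℝ}

/-- A localized bound for the empirical process indexed by `H`: the random factor `Z`, which is the
squared norm of the fluctuation of the empirical mean embedding with respect to the regularized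
covariance, is controlled in expectation by the effective dimension. -/
theorem exists_empiricalProcess_bound [TopologicalSpace.SeparableSpace H] [IsProbabilityMeasure μ]
    (hk : ∀ x y : X, kern H x y ≤ κ)
    (hk_meas : Measurable (Function.uncurry (kern H (X := X))))
    {B r : ℝ} (hB : 0 < B) (hr : 1 < r)
    (hdecay : ∀ l : ℕ, eigenvalue (kern H) μ l ≤ B * ((l : ℝ) + 1) ^ (-r))
    {n : ℕ} (hn : 0 < n) {η : ℝ} (hη : 0 < η) :
    ∃ Z : (Fin n → X) → ℝ≥0∞, Measurable Z ∧
      ∫⁻ D, Z D ∂(Measure.pi fun _ : Fin n => μ) ≤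
        ENNReal.ofReal (B ^ (1 / r) / (1 - 1 / r) * ((n : ℝ)⁻¹ * η ^ (-1 / r))) ∧
      ∀ D, Z D ≠ ∞ → ∀ (g : H) (c : ℝ), 0 < c →
        (n : ℝ)⁻¹ * ∑ j, g (D j) - ∫ x, g x ∂μ ≤
          c * (Var[g; μ] + η * ‖g‖ ^ 2) + (4 * c)⁻¹ * (Z D).toReal := by
  obtain ⟨ι, b, σ, hb⟩ := exists_hilbertBasis_eigenvectors
    (isCompactOperator_covOp (μ := μ) hk hk_meas) (isSymmetric_covOp hk hk_meas)
  -- Needed for the measurability of the series `Z` and for its termwise integration.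
  have hcount : Countable ι := b.orthonormal.countable_of_separableSpace
  have hσ : ∀ i, σ i = Var[b i; μ] := by
    intro i
    rw [← inner_covOp_self hk hk_meas, hb, real_inner_smul_left, real_inner_self_eq_norm_sq,
      b.orthonormal.1]
    simp
  have hσ0 : ∀ i, 0 ≤ σ i := fun i => hσ i ▸ variance_nonneg _ _
  have hση : ∀ i, 0 < σ i + η := fun i => add_pos_of_nonneg_of_pos (hσ0 i) hη
  let d : ι → (Fin n → X) → ℝ := fun i D => (n : ℝ)⁻¹ * ∑ j, b i (D j) - ∫ x, b i x ∂μ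
  have hdm : ∀ i, Measurable (d i) := by
    intro i
    have := measurable_apply hk_meas (b i)
    exact ((Finset.measurable_sum _ fun j _ => this.comp (measurable_pi_apply j)).const_mul
      _).sub_const _
  have hterm : ∀ i, Measurable fun D => ENNReal.ofReal ((σ i + η)⁻¹ * d i D ^ 2) :=
    fun i => (((hdm i).pow_const 2).const_mul _).ennreal_ofReal
  refine ⟨fun D => ∑' i, ENNReal.ofReal ((σ i + η)⁻¹ * d i D ^ 2),
    Measurable.tsum hterm, ?_, ?_⟩
  · rw [lintegral_tsum fun i => (hterm i).aemeasurable, ENNReal.tsum_eq_iSup_sum]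
    refine iSup_le fun s => ?_
    have h1 : ∀ i, ∫⁻ D, ENNReal.ofReal ((σ i + η)⁻¹ * d i D ^ 2)
        ∂(Measure.pi fun _ : Fin n => μ) ≤
        ENNReal.ofReal ((n : ℝ)⁻¹ * η⁻¹ * min (σ i) η) := by
      intro i
      simp_rw [ENNReal.ofReal_mul (inv_nonneg.mpr (hση i).le)]
      rw [lintegral_const_mul _ ((hdm i).pow_const 2).ennreal_ofReal,
        lintegral_empiricalMean_sub_sq (memLp_apply hk hk_meas (b i) 2) hn,
        ← ENNReal.ofReal_mul (inv_nonneg.mpr (hση i).le), ← hσ]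
      refine ENNReal.ofReal_le_ofReal ?_
      -- The variance of `d i` is `σ i / n`, so this is the `i`-th term of the effective dimension.
      have hmin : (σ i + η)⁻¹ * σ i ≤ η⁻¹ * min (σ i) η := by
        rw [inv_mul_eq_div, inv_mul_eq_div, div_le_div_iff₀ (hση i) hη]
        rcases le_total (σ i) η with h | h
        · rw [min_eq_left h]; nlinarith [hσ0 i]
        · rw [min_eq_right h]; nlinarith [hσ0 i]
      have := mul_le_mul_of_nonneg_left hmin (inv_nonneg.mpr (Nat.cast_nonneg (α := ℝ) n))
      linarith
    refine (Finset.sum_le_sum fun i _ => h1 i).trans ?_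
    rw [← ENNReal.ofReal_sum_of_nonneg fun i _ =>
      mul_nonneg (by positivity) (le_min (hσ0 i) hη.le), ← Finset.mul_sum]
    refine ENNReal.ofReal_le_ofReal ?_
    refine (mul_le_mul_of_nonneg_left (sum_min_eigenvalue_le hk hk_meas hB hr hdecay b.orthonormal
      hσ0 hb hη s) (by positivity)).trans (le_of_eq ?_)
    rw [show (1 : ℝ) - 1 / r = 1 + -1 / r by ring, Real.rpow_add hη, Real.rpow_one]
    field_simp
  · intro D hZ g c hc
    -- `Δ` represents the fluctuation, which is linear in the function; Parseval then splits it
    -- along the eigenbasis.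
    let Δ : H := (n : ℝ)⁻¹ • ∑ j, feature H (D j) - meanFeature H μ
    have hΔ : ∀ h : H, inner ℝ h Δ = (n : ℝ)⁻¹ * ∑ j, h (D j) - ∫ x, h x ∂μ := by
      intro h
      simp only [Δ]
      rw [inner_sub_right, real_inner_smul_right, inner_sum, inner_meanFeature hk hk_meas]
      simp
    have hs1 := b.hasSum_inner_mul_inner g Δ
    rw [hΔ] at hs1
    have hs2 := ((hasSum_eigenvalue_mul_inner_sq b (isSymmetric_covOp (μ := μ) hk hk_meas) hb
      g).add ((hasSum_inner_sq b g).mul_left η)).mul_left c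
    rw [inner_covOp_self hk hk_meas] at hs2
    have hs3 := (ENNReal.hasSum_toReal hZ).mul_left (4 * c)⁻¹
    rw [← ENNReal.tsum_toReal_eq fun i => ENNReal.ofReal_ne_top] at hs3
    refine hasSum_le (fun i => ?_) hs1 (hs2.add hs3)
    rw [hΔ, ENNReal.toReal_ofReal (mul_nonneg (inv_nonneg.mpr (hση i).le) (sq_nonneg _)),
      real_inner_comm]
    change inner ℝ (b i) g * d i D ≤ _
    set u := inner ℝ (b i) g
    set v := d i D
    set w := σ i + η with hw
    have hwpos : 0 < w := hση i
    -- Young's inequality `u v ≤ c w u² + v² / (4 c w)` in one coordinate.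
    have key : 0 ≤ c * w * (u - (2 * c * w)⁻¹ * v) ^ 2 := by positivity
    have e : c * w * (u - (2 * c * w)⁻¹ * v) ^ 2 =
        c * (σ i * u ^ 2 + η * u ^ 2) + (4 * c)⁻¹ * (w⁻¹ * v ^ 2) - u * v := by
      rw [← add_mul, ← hw]
      field_simp
      ring
    linarith

end Empirical

/-! ### Divergence and variance of bounded tiltings. -/

section Tilting

open InformationTheory ProbabilityTheory

/-- With `s = e^(u/2)`, `e^u - 1 - u = (s - 1)² + 2 (s - 1 - u/2)`, whose last bracket is
nonnegative. Moreover `|s - 1|` is at least `|u|/2` for `u ≥ 0` and at least `s |u|/2` for `u ≤ 0`.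
-/
theorem add_one_add_sq_le_exp {u a : ℝ} (hu : |u| ≤ a) :
    1 + u + Real.exp (-a) / 4 * u ^ 2 ≤ Real.exp u := by
  obtain ⟨h1, h2⟩ := abs_le.mp hu
  set s := Real.exp (u / 2) with hs
  have hss : Real.exp u = s ^ 2 := by rw [hs, ← Real.exp_nat_mul]; congr 1; push_cast; ring
  have hs1 : u / 2 + 1 ≤ s := Real.add_one_le_exp _
  have hquad : Real.exp (-a) / 4 * u ^ 2 ≤ (s - 1) ^ 2 := by
    rcases le_total 0 u with h | h
    · have he : Real.exp (-a) ≤ 1 := Real.exp_le_one_iff.mpr (by linarith)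
      have : (u / 2) ^ 2 ≤ (s - 1) ^ 2 := pow_le_pow_left₀ (by linarith) (by linarith) 2
      nlinarith [sq_nonneg u]
    · have hinv : s * Real.exp (-(u / 2)) = 1 := by rw [hs, ← Real.exp_add]; simp
      have hspos : 0 < s := Real.exp_pos _
      have h3 : s * (-(u / 2)) ≤ 1 - s := by
        have := mul_le_mul_of_nonneg_left (Real.add_one_le_exp (-(u / 2))) hspos.le
        linarith
      have h4 : (s * (-(u / 2))) ^ 2 ≤ (1 - s) ^ 2 :=
        pow_le_pow_left₀ (mul_nonneg hspos.le (by linarith)) h3 2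
      have h5 : Real.exp (-a) ≤ s ^ 2 := by rw [← hss]; exact Real.exp_le_exp.mpr h1
      have h6 := mul_le_mul_of_nonneg_right h5 (sq_nonneg (u / 2))
      linarith
  rw [hss]
  nlinarith

theorem exp_sub_one_mul_self_le {u a : ℝ} (hu : |u| ≤ a) :
    (Real.exp u - 1) * u ≤ Real.exp a * u ^ 2 := by
  obtain ⟨h1, h2⟩ := abs_le.mp hu
  have ha : 0 ≤ a := (abs_nonneg u).trans hu
  rcases le_total 0 u with h | h
  · have h3 : Real.exp u - 1 ≤ Real.exp u * u := by
      have := mul_le_mul_of_nonneg_left (Real.add_one_le_exp (-u)) (Real.exp_pos u).le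
      rw [← Real.exp_add] at this
      simp at this
      linarith
    have h4 : Real.exp u * u ≤ Real.exp a * u :=
      mul_le_mul_of_nonneg_right (Real.exp_le_exp.mpr h2) h
    nlinarith
  · have h3 := Real.add_one_le_exp u
    have h4 : (1 : ℝ) ≤ Real.exp a := Real.one_le_exp ha
    nlinarith [sq_nonneg u]

variable {X : Type*} [MeasurableSpace X] {μ : Measure X} {g : X → ℝ} {G : ℝ}

theorem integrable_exp_of_bounded [IsFiniteMeasure μ] (hg : Measurable g) (hG : ∀ x, |g x| ≤ G) :
    Integrable (fun x => Real.exp (g x)) μ :=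
  Integrable.of_bound hg.exp.aestronglyMeasurable (Real.exp G) (ae_of_all _ fun x => by
    rw [Real.norm_eq_abs, Real.abs_exp]
    exact Real.exp_le_exp.mpr ((le_abs_self _).trans (hG x)))

theorem integrable_of_bounded [IsFiniteMeasure μ] (hg : Measurable g) (hG : ∀ x, |g x| ≤ G) :
    Integrable g μ :=
  Integrable.of_bound hg.aestronglyMeasurable G (ae_of_all _ fun x => hG x)

theorem abs_integral_le_of_bounded [IsProbabilityMeasure μ] (hG : ∀ x, |g x| ≤ G) :
    |∫ x, g x ∂μ| ≤ G := by
  have := norm_integral_le_of_norm_le_const (μ := μ) (f := g) (ae_of_all _ fun x => hG x)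
  simpa using this

theorem abs_sub_integral_le_of_bounded [IsProbabilityMeasure μ] (hG : ∀ x, |g x| ≤ G) (x : X) :
    |g x - ∫ y, g y ∂μ| ≤ 2 * G := by
  have h1 := abs_integral_le_of_bounded (μ := μ) hG
  have h2 := hG x
  have := abs_sub (g x) (∫ y, g y ∂μ)
  linarith

/-- The log-partition terms of the two divergences cancel. -/
theorem symmKL_tilted [IsProbabilityMeasure μ] (hg : Measurable g) (hG : ∀ x, |g x| ≤ G) :
    symmKL μ (μ.tilted g) = ENNReal.ofReal (∫ x, g x ∂(μ.tilted g) - ∫ x, g x ∂μ) := by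
  have he := integrable_exp_of_bounded (μ := μ) hg hG
  have hp := isProbabilityMeasure_tilted he
  have hac : μ ≪ μ.tilted g := absolutelyContinuous_tilted he
  have hac' : μ.tilted g ≪ μ := tilted_absolutelyContinuous μ g
  have hgi := integrable_of_bounded (μ := μ) hg hG
  have hgi' := integrable_of_bounded (μ := μ.tilted g) hg hG
  have hllr : Integrable (llr μ μ) μ := (integrable_zero _ _ _).congr (llr_self μ).symm
  have hi1 : Integrable (llr μ (μ.tilted g)) μ :=
    integrable_llr_tilted_right .rfl hgi hllr he
  have h1 : ∫ x, llr μ (μ.tilted g) x ∂μ = Real.log (∫ x, Real.exp (g x) ∂μ) - ∫ x, g x ∂μ := by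
    rw [integral_llr_tilted_right .rfl hgi he hllr, integral_congr_ae (llr_self μ)]
    simp
    ring
  have hl : llr (μ.tilted g) μ =ᵐ[μ.tilted g]
      fun x => g x - Real.log (∫ x, Real.exp (g x) ∂μ) :=
    hac'.ae_le (log_rnDeriv_tilted_left_self he)
  have hi2 : Integrable (llr (μ.tilted g) μ) (μ.tilted g) :=
    (hgi'.sub (integrable_const _)).congr hl.symm
  have h2 : ∫ x, llr (μ.tilted g) μ x ∂(μ.tilted g) =
      ∫ x, g x ∂(μ.tilted g) - Real.log (∫ x, Real.exp (g x) ∂μ) := by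
    rw [integral_congr_ae hl, integral_sub hgi' (integrable_const _)]
    simp
  have n1 := integral_llr_add_sub_measure_univ_nonneg hac hi1
  have n2 := integral_llr_add_sub_measure_univ_nonneg hac' hi2
  rw [symmKL, klDiv_of_ac_of_integrable hac hi1, klDiv_of_ac_of_integrable hac' hi2,
    ← ENNReal.ofReal_add n1 n2, h1, h2]
  simp

/-- The symmetrized divergence of a bounded tilting is at most a multiple of the variance. -/
theorem symmKL_tilted_le [IsProbabilityMeasure μ] (hg : Measurable g) (hG : ∀ x, |g x| ≤ G) :
    symmKL μ (μ.tilted g) ≤ ENNReal.ofReal (Real.exp (2 * G) * Var[g; μ]) := by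
  rw [symmKL_tilted hg hG]
  refine ENNReal.ofReal_le_ofReal ?_
  set m := ∫ x, g x ∂μ with hm
  have he := integrable_exp_of_bounded (μ := μ) hg hG
  have hp := isProbabilityMeasure_tilted he
  have hgi := integrable_of_bounded (μ := μ) hg hG
  have hgi' := integrable_of_bounded (μ := μ.tilted g) hg hG
  have hb : ∀ x, |g x - m| ≤ 2 * G := abs_sub_integral_le_of_bounded hG
  have hum : Measurable fun x => g x - m := hg.sub_const m
  have hui := integrable_of_bounded (μ := μ) hum hb
  have hue := integrable_exp_of_bounded (μ := μ) hum hb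
  have hu0 : ∫ x, (g x - m) ∂μ = 0 := by
    rw [integral_sub hgi (integrable_const _)]; simp [hm]
  have hu2 : Integrable (fun x => (g x - m) ^ 2) μ :=
    ((MemLp.of_bound hum.aestronglyMeasurable (2 * G) (ae_of_all _ hb) :
      MemLp _ 2 μ)).integrable_sq
  -- Centring makes the normalizing constant at least `1`, so it can be dropped from the denominator
  -- in `key`.
  have hS : 1 ≤ ∫ x, Real.exp (g x - m) ∂μ := by
    have h := integral_mono (hui.add (integrable_const (1 : ℝ))) hue
      (fun x => Real.add_one_le_exp (g x - m))
    rw [integral_add' hui (integrable_const _), hu0] at h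
    simpa using h
  have hueu : Integrable (fun x => Real.exp (g x - m) * (g x - m)) μ := by
    refine hui.bdd_mul (c := Real.exp (2 * G)) hum.exp.aestronglyMeasurable
      (ae_of_all _ fun x => ?_)
    rw [Real.norm_eq_abs, Real.abs_exp]
    exact Real.exp_le_exp.mpr ((le_abs_self _).trans (hb x))
  have hnum : ∫ x, Real.exp (g x - m) * (g x - m) ∂μ ≤ Real.exp (2 * G) * Var[g; μ] := by
    rw [variance_eq_integral hg.aemeasurable, ← integral_const_mul]
    have e : ∫ x, Real.exp (g x - m) * (g x - m) ∂μ =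
        ∫ x, (Real.exp (g x - m) * (g x - m) - (g x - m)) ∂μ := by
      rw [integral_sub hueu hui, hu0, sub_zero]
    -- Subtracting the mean-zero term turns `e^u u` into `(e^u - 1) u`, which is quadratic in `u`.
    rw [e]
    refine integral_mono (hueu.sub hui) (hu2.const_mul _) fun x => ?_
    have := exp_sub_one_mul_self_le (hb x)
    simp only
    linarith
  have key : ∫ x, g x ∂(μ.tilted g) - m =
      (∫ x, Real.exp (g x - m) * (g x - m) ∂μ) / ∫ x, Real.exp (g x - m) ∂μ := by
    have h1 : ∫ x, (g x - m) ∂(μ.tilted g) = ∫ x, g x ∂(μ.tilted g) - m := by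
      rw [integral_sub hgi' (integrable_const _)]; simp
    rw [← h1, integral_tilted]
    simp_rw [Real.exp_sub, div_eq_mul_inv, smul_eq_mul]
    rw [integral_mul_const, ← div_eq_mul_inv, ← integral_div]
    congr 1
    ext x
    have : (∫ x, Real.exp (g x) ∂μ) ≠ 0 := (integral_exp_pos he).ne'
    have := Real.exp_pos m
    field_simp
  rw [key]
  have hpos : 0 ≤ Real.exp (2 * G) * Var[g; μ] :=
    mul_nonneg (Real.exp_pos _).le (variance_nonneg _ _)
  rw [div_le_iff₀ (by linarith)]
  nlinarith

/-- The divergence of a bounded tilting is at least a multiple of the variance. -/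
theorem variance_le_log_integral_exp [IsProbabilityMeasure μ] (hg : Measurable g)
    (hG : ∀ x, |g x| ≤ G) :
    Real.exp (-(2 * G)) / (4 * (1 + G ^ 2)) * Var[g; μ] ≤
      Real.log (∫ x, Real.exp (g x) ∂μ) - ∫ x, g x ∂μ := by
  set m := ∫ x, g x ∂μ with hm
  have he := integrable_exp_of_bounded (μ := μ) hg hG
  have hgi := integrable_of_bounded (μ := μ) hg hG
  have hb : ∀ x, |g x - m| ≤ 2 * G := abs_sub_integral_le_of_bounded hG
  have hum : Measurable fun x => g x - m := hg.sub_const m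
  have hui := integrable_of_bounded (μ := μ) hum hb
  have hue := integrable_exp_of_bounded (μ := μ) hum hb
  have hu0 : ∫ x, (g x - m) ∂μ = 0 := by
    rw [integral_sub hgi (integrable_const _)]; simp [hm]
  have hu2 : Integrable (fun x => (g x - m) ^ 2) μ :=
    ((MemLp.of_bound hum.aestronglyMeasurable (2 * G) (ae_of_all _ hb) :
      MemLp _ 2 μ)).integrable_sq
  have hV : Var[g; μ] = ∫ x, (g x - m) ^ 2 ∂μ := variance_eq_integral hg.aemeasurable
  have hVle : Var[g; μ] ≤ 4 * G ^ 2 := by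
    rw [hV]
    have h := integral_mono hu2 (integrable_const (4 * G ^ 2)) (fun x => by
      have := sq_le_sq' (abs_le.mp (hb x)).1 (abs_le.mp (hb x)).2
      simp only
      linarith)
    simpa using h
  have hV0 : 0 ≤ Var[g; μ] := variance_nonneg _ _
  have hG0 : 0 ≤ G := (abs_nonneg _).trans (abs_integral_le_of_bounded (μ := μ) hG)
  set y := Real.exp (-(2 * G)) / 4 * Var[g; μ] with hy
  have hy0 : 0 ≤ y := mul_nonneg (by positivity) hV0
  -- The logarithm is bounded below by `log (1 + y) ≥ y / (1 + y)`; this crude bound on `y` produces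
  -- the factor `1 + G²`.
  have hyle : y ≤ G ^ 2 := by
    have : Real.exp (-(2 * G)) ≤ 1 := Real.exp_le_one_iff.mpr (by linarith)
    rw [hy]
    nlinarith
  have hS : 1 + y ≤ ∫ x, Real.exp (g x - m) ∂μ := by
    have h := integral_mono (((integrable_const (1 : ℝ)).add hui).add
      (hu2.const_mul (Real.exp (-(2 * G)) / 4))) hue (fun x => add_one_add_sq_le_exp (hb x))
    rw [integral_add' ((integrable_const (1 : ℝ)).add hui) (hu2.const_mul _),
      integral_add' (integrable_const _) hui, hu0, integral_const_mul, ← hV] at h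
    simpa using h
  have hlog : Real.log (∫ x, Real.exp (g x - m) ∂μ) = Real.log (∫ x, Real.exp (g x) ∂μ) - m := by
    simp_rw [Real.exp_sub]
    rw [integral_div, Real.log_div (integral_exp_pos he).ne' (Real.exp_pos _).ne', Real.log_exp]
  rw [← hlog]
  refine le_trans ?_ (Real.log_le_log (by linarith) hS)
  refine le_trans ?_ (Real.one_sub_inv_le_log_of_pos (by linarith))
  have h1 : 1 - (1 + y)⁻¹ = y / (1 + y) := by field_simp; ring
  have h2 : Real.exp (-(2 * G)) / (4 * (1 + G ^ 2)) * Var[g; μ] = y / (1 + G ^ 2) := by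
    rw [hy]; field_simp
  rw [h1, h2]
  exact div_le_div_of_nonneg_left hy0 (by linarith) (by linarith)

end Tilting

/-! ### Saddle points as approximate likelihood maximizers. -/

section Saddle

open InformationTheory ProbabilityTheory

variable {X : Type*} [MeasurableSpace X]

theorem expFam_eq_tilted {base : Measure X} [NeZero base] {f : X → ℝ}
    (hf : Integrable (fun x => Real.exp (f x)) base) : expFam base f = base.tilted f := by
  have : ∀ x, Real.exp (f x - logPartition base f) =
      Real.exp (f x) / ∫ x, Real.exp (f x) ∂base := fun x => by
    rw [Real.exp_sub, logPartition, Real.exp_log (integral_exp_pos hf)]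
  simp_rw [expFam, ofDensity, this]
  rfl

theorem isFiniteMeasure_ofDensity {vol : Measure X} [IsFiniteMeasure vol] {p : X → ℝ} {C : ℝ}
    (hp : ∀ x, p x ≤ C) : IsFiniteMeasure (ofDensity vol p) := by
  refine isFiniteMeasure_withDensity (ne_of_lt ?_)
  calc ∫⁻ x, ENNReal.ofReal (p x) ∂vol ≤ ∫⁻ _, ENNReal.ofReal C ∂vol :=
        lintegral_mono fun x => ENNReal.ofReal_le_ofReal (hp x)
    _ < ∞ := by
        rw [lintegral_const]
        exact ENNReal.mul_lt_top ENNReal.ofReal_lt_top (measure_lt_top _ _)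

theorem neZero_ofDensity {vol : Measure X} [NeZero vol] {p : X → ℝ} (hpm : Measurable p)
    (hp : ∀ x, 0 < p x) : NeZero (ofDensity vol p) := by
  refine ⟨fun h => NeZero.ne vol ?_⟩
  rw [ofDensity, withDensity_eq_zero_iff hpm.ennreal_ofReal.aemeasurable] at h
  have : ∀ᵐ _ ∂vol, False := by
    filter_upwards [h] with x hx
    have := hp x
    simp only [Pi.zero_apply, ENNReal.ofReal_eq_zero] at hx
    linarith
  simpa using this

/-- The variational inequality of Donsker and Varadhan, relative to an exponential family. -/
theorem integral_sub_integral_exp_le {base ρ : Measure X} [IsFiniteMeasure base] [NeZero base]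
    [IsProbabilityMeasure ρ] {f ν : X → ℝ} (hf : Integrable (fun x => Real.exp (f x)) base)
    (hfρ : Integrable f ρ) (hνρ : Integrable ν ρ)
    (hν : Integrable (fun x => Real.exp (ν x)) base)
    (hkl : klDiv ρ (expFam base f) ≠ ∞) :
    ∫ x, ν x ∂ρ - ∫ x, Real.exp (ν x) ∂base ≤
      (klDiv ρ (expFam base f)).toReal + ∫ x, f x ∂ρ - logPartition base f - 1 := by
  rw [expFam_eq_tilted hf] at hkl ⊢
  have hp := isProbabilityMeasure_tilted hf
  obtain ⟨hac, hllr⟩ := klDiv_ne_top_iff.mp hkl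
  have hfw : f + (ν - f) = ν := by ext x; simp
  have hw : Integrable (fun x => Real.exp ((ν - f) x)) (base.tilted f) := by
    rw [integrable_tilted_iff hf]
    refine hν.congr (ae_of_all _ fun x => ?_)
    simp only [Pi.sub_apply, smul_eq_mul, ← Real.exp_add]
    congr 1
    ring
  have hpw := isProbabilityMeasure_tilted hw
  -- Tilting `p_f` by `ν - f` gives `p_ν`, and `KL(ρ ‖ p_ν) ≥ 0` is the inequality with `log ∫ e^ν`;
  -- then `log x ≤ x - 1` yields the stated form.
  have hgibbs := integral_llr_add_sub_measure_univ_nonneg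
    (hac.trans (absolutelyContinuous_tilted hw))
    (integrable_llr_tilted_right hac (hνρ.sub hfρ) hllr hw)
  rw [integral_llr_tilted_right hac (hνρ.sub hfρ) hw hllr, integral_exp_tilted, hfw,
    Real.log_div (integral_exp_pos hν).ne' (integral_exp_pos hf).ne', integral_sub' hνρ hfρ]
    at hgibbs
  rw [toReal_klDiv_of_measure_eq hac (by simp)]
  have hlog := Real.log_le_sub_one_of_pos (integral_exp_pos hν)
  simp only [probReal_univ] at hgibbs
  rw [logPartition]
  linarith

variable {H : Type*} [NormedAddCommGroup H] [InnerProductSpace ℝ H]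
  [CompleteSpace H] [RKHS ℝ H X ℝ]

/-- The penalized log-likelihood of the potential `f` for the sample `D`. -/
noncomputable def penalizedLogLik (base : Measure X) (η : ℝ) {n : ℕ} (D : Fin n → X) (f : H) : ℝ :=
  (n : ℝ)⁻¹ * ∑ i, f (D i) - logPartition base f - η / 2 * ‖f‖ ^ 2

variable {vol : Measure X} {p₀ : X → ℝ} {κ η : ℝ} {n : ℕ} {D : Fin n → X}

theorem le_value [NeZero (ofDensity vol p₀)] [IsFiniteMeasure (ofDensity vol p₀)]
    (hk : ∀ x y : X, kern H x y ≤ κ)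
    (hk_meas : Measurable (Function.uncurry (kern H (X := X)))) {q : X → ℝ}
    (hq : IsDensity vol q) (f : H) :
    ((penalizedLogLik (ofDensity vol p₀) η D f - 1 : ℝ) : EReal) ≤ value vol p₀ η D f q := by
  have hqp := hq.isProbabilityMeasure
  set base := ofDensity vol p₀ with hbase
  have hfm := measurable_apply hk_meas f
  have he := integrable_exp_of_bounded (μ := base) hfm (abs_apply_le hk f)
  have hfq := integrable_of_bounded (μ := ofDensity vol q) hfm (abs_apply_le hk f)
  -- The log-density of `p_f`: its exponential has integral `1`, whence the `-1` in the bound.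
  let ν : X → ℝ := fun x => f x - logPartition base f
  have hexp : ∀ x, Real.exp (ν x) = Real.exp (f x) / ∫ x, Real.exp (f x) ∂base := fun x => by
    simp only [ν]
    rw [Real.exp_sub, logPartition, Real.exp_log (integral_exp_pos he)]
  have hadm : Admissible vol p₀ q ν := by
    refine ⟨hfm.sub_const _, hfq.sub (integrable_const _), ?_⟩
    simp_rw [hexp]
    exact he.div_const _
  refine le_trans (le_of_eq ?_) (le_iSup₂ (f := fun (ν : X → ℝ) (_ : Admissible vol p₀ q ν) =>
    ((objective vol p₀ η D f ν q : ℝ) : EReal)) ν hadm)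
  congr 1
  simp only [objective, penalizedLogLik, ← hbase]
  simp_rw [hexp]
  rw [integral_div, div_self (integral_exp_pos he).ne']
  simp only [ν]
  rw [integral_sub hfq (integrable_const _)]
  simp
  ring

theorem value_le [NeZero (ofDensity vol p₀)] [IsFiniteMeasure (ofDensity vol p₀)]
    (hk : ∀ x y : X, kern H x y ≤ κ)
    (hk_meas : Measurable (Function.uncurry (kern H (X := X)))) {q : X → ℝ}
    (hq : IsDensity vol q) (f : H)
    (hkl : klDiv (ofDensity vol q) (expFam (ofDensity vol p₀) f) ≠ ∞) :
    value vol p₀ η D f q ≤ ((penalizedLogLik (ofDensity vol p₀) η D f - 1 +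
      (klDiv (ofDensity vol q) (expFam (ofDensity vol p₀) f)).toReal : ℝ) : EReal) := by
  have hqp := hq.isProbabilityMeasure
  have hfm := measurable_apply hk_meas f
  refine iSup₂_le fun ν hν => EReal.coe_le_coe_iff.mpr ?_
  have := integral_sub_integral_exp_le (integrable_exp_of_bounded hfm (abs_apply_le hk f))
    (integrable_of_bounded hfm (abs_apply_le hk f)) hν.2.1 hν.2.2 hkl
  simp only [objective, penalizedLogLik]
  linarith

/-- A saddle point maximizes the penalized likelihood up to the approximation error. -/
theorem IsSaddle.penalizedLogLik_sub_le [NeZero (ofDensity vol p₀)]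
    [IsFiniteMeasure (ofDensity vol p₀)] (hk : ∀ x y : X, kern H x y ≤ κ)
    (hk_meas : Measurable (Function.uncurry (kern H (X := X)))) {F : Set H} {P : Set (X → ℝ)}
    (hP : ∀ q ∈ P, IsDensity vol q) {f : H} {q : X → ℝ} (h : IsSaddle vol p₀ F P η D f q) {g : H}
    (hg : g ∈ F) :
    ENNReal.ofReal (penalizedLogLik (ofDensity vol p₀) η D g -
      penalizedLogLik (ofDensity vol p₀) η D f) ≤ approxError vol p₀ F P := by
  -- The supremum in the approximation error is needed because `f` depends on the sample.
  refine le_trans ?_ (le_iSup₂ (f := fun (f : H) (_ : f ∈ F) => ⨅ q ∈ P,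
    klDiv (ofDensity vol q) (expFam (ofDensity vol p₀) f)) f h.mem_primal)
  refine le_iInf₂ fun q' hq' => ?_
  by_cases hkl : klDiv (ofDensity vol q') (expFam (ofDensity vol p₀) f) = ∞
  · rw [hkl]; exact le_top
  refine ENNReal.ofReal_le_of_le_toReal ?_
  have := (le_value hk hk_meas (hP q h.mem_dual) g).trans <| (h.primal_optimal g hg).trans <|
    (h.dual_optimal q' hq').trans (value_le hk hk_meas (hP q' hq') f hkl)
  have := EReal.coe_le_coe_iff.mp this
  linarith

end Saddle

/-! ### The rate for every sample size and regularization. -/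

section Rate

open InformationTheory ProbabilityTheory

variable {X H : Type*} [MeasurableSpace X] {vol : Measure X}
  [NormedAddCommGroup H] [InnerProductSpace ℝ H] [CompleteSpace H] [RKHS ℝ H X ℝ]
  {p₀ : X → ℝ} {κ η : ℝ}

omit [CompleteSpace H] in
theorem badSamples_anti (F : Set H) (P : Set (X → ℝ)) (n : ℕ) (fstar : H) {R R' : ℝ≥0∞}
    (h : R ≤ R') :
    badSamples vol p₀ F P η n fstar R' ⊆ badSamples vol p₀ F P η n fstar R := by
  rintro D ⟨f, q, hs, hlt⟩
  exact ⟨f, q, hs, h.trans_lt hlt⟩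

/-- The error of a saddle point in terms of the fluctuation of the sample. -/
theorem IsSaddle.symmKL_le [NeZero (ofDensity vol p₀)] [IsFiniteMeasure (ofDensity vol p₀)]
    (hk : ∀ x y : X, kern H x y ≤ κ)
    (hk_meas : Measurable (Function.uncurry (kern H (X := X))))
    {F : Set H} {C_H : ℝ} (hC_H : ∀ f ∈ F, ‖f‖ ≤ C_H) {fstar : H} (hfstar : fstar ∈ F)
    {P : Set (X → ℝ)} (hP : ∀ q ∈ P, IsDensity vol q) {n : ℕ} (hη : 0 < η) {D : Fin n → X}
    {f : H} {q : X → ℝ} (hs : IsSaddle vol p₀ F P η D f q) {c G z : ℝ}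
    (hG : G = 2 * C_H * √κ) (hc : c = Real.exp (-(2 * G)) / (4 * (1 + G ^ 2)))
    (hz : ∀ g : H, (n : ℝ)⁻¹ * ∑ j, g (D j) - ∫ x, g x ∂(expFam (ofDensity vol p₀) fstar) ≤
      c / 2 * (Var[g; expFam (ofDensity vol p₀) fstar] + η * ‖g‖ ^ 2) + (4 * (c / 2))⁻¹ * z) :
    symmKL (expFam (ofDensity vol p₀) fstar) (expFam (ofDensity vol p₀) f) ≤
      ENNReal.ofReal (Real.exp (2 * G) * (c⁻¹ ^ 2 * z + (4 * C_H ^ 2 + C_H ^ 2 * c⁻¹) * η)) +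
      ENNReal.ofReal (Real.exp (2 * G) * (2 * c⁻¹)) * approxError vol p₀ F P := by
  have hgap := hs.penalizedLogLik_sub_le hk hk_meas hP hfstar
  set base := ofDensity vol p₀
  set a := penalizedLogLik base η D fstar - penalizedLogLik base η D f with ha
  have hcpos : 0 < c := by rw [hc]; positivity
  have hest := integrable_exp_of_bounded (μ := base) (measurable_apply hk_meas fstar)
    (abs_apply_le hk fstar)
  have hef := integrable_exp_of_bounded (μ := base) (measurable_apply hk_meas f)
    (abs_apply_le hk f)
  let g : H := f - fstar
  have hfg : (fstar : X → ℝ) + g = f := by simp [g]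
  have hgn : ‖g‖ ≤ 2 * C_H := by
    have := norm_sub_le f fstar
    have := hC_H f hs.mem_primal
    have := hC_H fstar hfstar
    simp only [g]
    linarith
  have hgG : ∀ x, |g x| ≤ G := fun x => (abs_apply_le hk g x).trans
    (hG ▸ mul_le_mul_of_nonneg_right hgn (Real.sqrt_nonneg _))
  have hgm := measurable_apply hk_meas g
  have hstar : expFam base fstar = base.tilted fstar := expFam_eq_tilted hest
  have hp : IsProbabilityMeasure (expFam base fstar) := hstar ▸ isProbabilityMeasure_tilted hest
  have htilt : expFam base f = (expFam base fstar).tilted g := by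
    rw [expFam_eq_tilted hef, hstar, tilted_tilted hest, hfg]
  have hlog : Real.log (∫ x, Real.exp (g x) ∂(expFam base fstar)) =
      logPartition base f - logPartition base fstar := by
    rw [hstar, integral_exp_tilted, hfg,
      Real.log_div (integral_exp_pos hef).ne' (integral_exp_pos hest).ne']
    rfl
  have hlow := variance_le_log_integral_exp (μ := expFam base fstar) hgm hgG
  rw [← hc, hlog] at hlow
  have hup := symmKL_tilted_le (μ := expFam base fstar) hgm hgG
  rw [← htilt] at hup
  have hzg := hz g
  set V := Var[g; expFam base fstar]
  have hsum : (n : ℝ)⁻¹ * ∑ j, g (D j) =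
      (n : ℝ)⁻¹ * ∑ j, f (D j) - (n : ℝ)⁻¹ * ∑ j, fstar (D j) := by
    simp [g, mul_sub]
  have hgn2 : ‖g‖ ^ 2 ≤ 4 * C_H ^ 2 := by
    have := pow_le_pow_left₀ (norm_nonneg g) hgn 2
    linarith
  have hfs2 : ‖fstar‖ ^ 2 ≤ C_H ^ 2 := pow_le_pow_left₀ (norm_nonneg _) (hC_H fstar hfstar) 2
  have hmax : a ≤ max a 0 := le_max_left _ _
  -- The divergence supplies `c V` and the fluctuation costs `c/2 V`, so half survives. The
  -- truncation `max a 0` matches the `ENNReal` bound on the likelihood gap.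
  have hmain : c / 2 * V ≤ max a 0 + c / 2 * (4 * C_H ^ 2 * η) + (4 * (c / 2))⁻¹ * z +
      η / 2 * C_H ^ 2 := by
    have h1 := mul_le_mul_of_nonneg_left hgn2 (by positivity : 0 ≤ c / 2 * η)
    have h2 := mul_le_mul_of_nonneg_left hfs2 (by positivity : 0 ≤ η / 2)
    have h3 : 0 ≤ η / 2 * ‖f‖ ^ 2 := by positivity
    simp only [penalizedLogLik] at ha
    linarith
  have hV : V ≤ (c⁻¹ ^ 2 * z + (4 * C_H ^ 2 + C_H ^ 2 * c⁻¹) * η) + 2 * c⁻¹ * max a 0 := by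
    have := mul_le_mul_of_nonneg_left hmain (by positivity : 0 ≤ 2 * c⁻¹)
    have e1 : 2 * c⁻¹ * (c / 2 * V) = V := by field_simp
    have e2 : 2 * c⁻¹ * (max a 0 + c / 2 * (4 * C_H ^ 2 * η) + (4 * (c / 2))⁻¹ * z +
      η / 2 * C_H ^ 2) = (c⁻¹ ^ 2 * z + (4 * C_H ^ 2 + C_H ^ 2 * c⁻¹) * η) +
        2 * c⁻¹ * max a 0 := by field_simp; ring
    rwa [e1, e2] at this
  refine hup.trans ?_
  refine (ENNReal.ofReal_le_ofReal (mul_le_mul_of_nonneg_left hV (Real.exp_pos _).le)).trans ?_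
  rw [mul_add]
  refine ENNReal.ofReal_add_le.trans (add_le_add le_rfl ?_)
  rw [← mul_assoc, ENNReal.ofReal_mul (by positivity)]
  refine mul_le_mul_right ?_ _
  rw [ENNReal.ofReal_max, ENNReal.ofReal_zero, max_eq_left zero_le]
  exact hgap

/-- The rate of convergence of the doubly dual estimator, for every sample size and every
regularization parameter. -/
theorem exists_measure_badSamples_le [IsFiniteMeasure vol] [TopologicalSpace.SeparableSpace H]
    (hp₀ : Measurable p₀) {c₀ C₀ : ℝ} (hc₀ : 0 < c₀) (hp₀_bdd : ∀ x, c₀ ≤ p₀ x ∧ p₀ x ≤ C₀)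
    (hk : ∀ x y : X, kern H x y ≤ κ)
    (hk_meas : Measurable (Function.uncurry (kern H (X := X))))
    {F : Set H} {C_H : ℝ} (hC_H : ∀ f ∈ F, ‖f‖ ≤ C_H) {fstar : H} (hfstar : fstar ∈ F)
    {r : ℝ} (hr : 1 < r)
    (hdecay : (fun l : ℕ => eigenvalue (kern H) (expFam (ofDensity vol p₀) fstar) l)
      =O[atTop] fun l : ℕ => ((l : ℝ) + 1) ^ (-r)) {δ : ℝ} (hδ : 0 < δ) :
    ∃ K : ℝ≥0, ∀ (n : ℕ) (η : ℝ), 0 < n → 0 < η →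
      ∀ P : Set (X → ℝ), (∀ q ∈ P, IsDensity vol q) →
        Measure.pi (fun _ : Fin n => expFam (ofDensity vol p₀) fstar)
          (badSamples vol p₀ F P η n fstar
            (K * (ENNReal.ofReal ((n : ℝ)⁻¹ * η ^ (-1 / r) + η) + approxError vol p₀ F P)))
          ≤ ENNReal.ofReal δ := by
  -- The zero measure has no probability density, so there are no saddle points.
  rcases eq_zero_or_neZero vol with h0 | h0
  · refine ⟨0, fun n η _ _ P hP => ?_⟩
    have : badSamples vol p₀ F P η n fstar (((0 : ℝ≥0) : ℝ≥0∞) *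
        (ENNReal.ofReal ((n : ℝ)⁻¹ * η ^ (-1 / r) + η) + approxError vol p₀ F P)) = ∅ := by
      rw [Set.eq_empty_iff_forall_notMem]
      rintro D ⟨f, q, hs, -⟩
      have := (hP q hs.mem_dual).isProbabilityMeasure
      have := measure_univ (μ := ofDensity vol q)
      simp [h0, ofDensity] at this
    rw [this, measure_empty]
    exact zero_le
  have hbf : IsFiniteMeasure (ofDensity vol p₀) :=
    isFiniteMeasure_ofDensity fun x => (hp₀_bdd x).2
  have hbn : NeZero (ofDensity vol p₀) :=
    neZero_ofDensity hp₀ fun x => hc₀.trans_le (hp₀_bdd x).1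
  have hest := integrable_exp_of_bounded (μ := ofDensity vol p₀) (measurable_apply hk_meas fstar)
    (abs_apply_le hk fstar)
  have hp : IsProbabilityMeasure (expFam (ofDensity vol p₀) fstar) :=
    expFam_eq_tilted hest ▸ isProbabilityMeasure_tilted hest
  obtain ⟨B, hB, hdec⟩ := exists_eigenvalue_le hdecay
  have hr1 : 1 / r < 1 := (div_lt_one (by linarith)).mpr hr
  set A := B ^ (1 / r) / (1 - 1 / r) with hA
  have hApos : 0 < A := div_pos (Real.rpow_pos_of_pos hB _) (by linarith)
  set G := 2 * C_H * √κ with hG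
  set c := Real.exp (-(2 * G)) / (4 * (1 + G ^ 2)) with hc
  have hcpos : 0 < c := by rw [hc]; positivity
  set K₁ := Real.exp (2 * G) * (c⁻¹ ^ 2 * (A / δ) + (4 * C_H ^ 2 + C_H ^ 2 * c⁻¹)) with hK₁
  set K₂ := Real.exp (2 * G) * (2 * c⁻¹) with hK₂
  have hK₁0 : 0 ≤ K₁ := by positivity
  have hK₂0 : 0 ≤ K₂ := by positivity
  refine ⟨(K₁ + K₂).toNNReal, fun n η hn hη P hP => ?_⟩
  have hn' : (0 : ℝ) < n := by exact_mod_cast hn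
  set w := (n : ℝ)⁻¹ * η ^ (-1 / r) with hw
  have hwpos : 0 < w := mul_pos (by positivity) (Real.rpow_pos_of_pos hη _)
  obtain ⟨Z, hZm, hZi, hZ⟩ := exists_empiricalProcess_bound hk hk_meas hB hr hdec hn hη
  -- The Markov threshold: the mean of `Z` is at most `A w = δ z`.
  set z := A / δ * w with hz
  have hzpos : 0 < z := by positivity
  have hsub : badSamples vol p₀ F P η n fstar (((K₁ + K₂).toNNReal : ℝ≥0∞) *
      (ENNReal.ofReal (w + η) + approxError vol p₀ F P)) ⊆ {D | ENNReal.ofReal z ≤ Z D} := by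
    rintro D ⟨f, q, hs, hlt⟩
    by_contra! hD
    simp only [Set.mem_ofPred_eq, not_le] at hD
    refine absurd hlt (not_lt.mpr ?_)
    have hZz : (Z D).toReal ≤ z := ENNReal.toReal_le_of_le_ofReal hzpos.le hD.le
    refine (hs.symmKL_le hk hk_meas hC_H hfstar hP hη (z := z) hG hc fun g => ?_).trans ?_
    · refine (hZ D hD.ne_top g (c / 2) (by positivity)).trans ?_
      gcongr
    · rw [mul_add ((K₁ + K₂).toNNReal : ℝ≥0∞)]
      have hKle : ∀ x, 0 ≤ x → x ≤ K₁ + K₂ → ENNReal.ofReal x ≤ ((K₁ + K₂).toNNReal : ℝ≥0∞) :=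
        fun x _ hx => ENNReal.ofReal_le_ofReal hx
      refine add_le_add ?_ (mul_le_mul_left (hKle K₂ hK₂0 (by linarith)) _)
      refine le_trans (ENNReal.ofReal_le_ofReal (q := K₁ * (w + η)) ?_) ?_
      · rw [hK₁, mul_assoc]
        refine mul_le_mul_of_nonneg_left ?_ (Real.exp_pos _).le
        have h1 : 0 ≤ c⁻¹ ^ 2 * (A / δ) * η := by positivity
        have h2 : 0 ≤ (4 * C_H ^ 2 + C_H ^ 2 * c⁻¹) * w := by positivity
        rw [hz]
        linarith
      · rw [ENNReal.ofReal_mul hK₁0]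
        exact mul_le_mul_left (hKle K₁ hK₁0 (by linarith)) _
  refine (measure_mono hsub).trans ?_
  refine (meas_ge_le_lintegral_div hZm.aemeasurable (by simpa using hzpos)
    ENNReal.ofReal_ne_top).trans ?_
  refine ENNReal.div_le_of_le_mul (hZi.trans ?_)
  rw [← ENNReal.ofReal_mul hδ.le]
  refine ENNReal.ofReal_le_ofReal (le_of_eq ?_)
  rw [hz, ← mul_assoc δ, mul_div_cancel₀ _ hδ.ne']

end Rate

end DoublyDual

open DoublyDual in
theorem theorem4 {X H : Type*} [MeasurableSpace X] (vol : Measure X) [IsFiniteMeasure vol]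
    [NormedAddCommGroup H] [InnerProductSpace ℝ H] [CompleteSpace H]
    [TopologicalSpace.SeparableSpace H] [RKHS ℝ H X ℝ]
    -- base density, bounded above and below
    (p₀ : X → ℝ) (hp₀ : Measurable p₀) (c₀ C₀ : ℝ) (hc₀ : 0 < c₀)
    (hp₀_bdd : ∀ x, c₀ ≤ p₀ x ∧ p₀ x ≤ C₀)
    -- bounded measurable kernel
    (κ : ℝ) (hk : ∀ x y, kern H x y ≤ κ) (hk_meas : Measurable (Function.uncurry (kern H (X := X))))
    -- the model: a convex, norm bounded set of potentials that contains the true one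
    (F : Set H) (hF : Convex ℝ F) (C_H : ℝ) (hC_H : ∀ f ∈ F, ‖f‖ ≤ C_H)
    (fstar : H) (hfstar : fstar ∈ F)
    -- decay of the eigenvalues of the kernel in L²(p*)
    (r : ℝ) (hr : 1 < r)
    (hdecay : (fun l : ℕ => eigenvalue (kern H) (expFam (ofDensity vol p₀) fstar) l)
      =O[atTop] fun l : ℕ => ((l : ℝ) + 1) ^ (-r))
    -- uniform bound on the dual densities
    (C_P : ℝ) :
    (∀ δ : ℝ, 0 < δ → ∃ (K : ℝ≥0) (η₀ M : ℝ), 0 < η₀ ∧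
      ∀ (n : ℕ) (η : ℝ), 0 < n → 0 < η → η ≤ η₀ → M ≤ n * η ^ (1 / r) →
      ∀ P : Set (X → ℝ), (∀ q ∈ P, IsDensity vol q ∧ ∀ x, q x ≤ C_P) →
        Measure.pi (fun _ : Fin n => expFam (ofDensity vol p₀) fstar)
          (badSamples vol p₀ F P η n fstar
            (K * (ENNReal.ofReal ((n : ℝ)⁻¹ * η ^ (-1 / r) + η) + approxError vol p₀ F P)))
          ≤ ENNReal.ofReal δ) ∧
    (∀ a b : ℝ, 0 < a → a ≤ b → ∀ δ : ℝ, 0 < δ → ∃ (K : ℝ≥0) (N : ℕ),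
      ∀ (n : ℕ) (η : ℝ), 0 < n → N ≤ n →
      a * (n : ℝ) ^ (-r / (1 + r)) ≤ η → η ≤ b * (n : ℝ) ^ (-r / (1 + r)) →
      ∀ P : Set (X → ℝ), (∀ q ∈ P, IsDensity vol q ∧ ∀ x, q x ≤ C_P) →
        Measure.pi (fun _ : Fin n => expFam (ofDensity vol p₀) fstar)
          (badSamples vol p₀ F P η n fstar
            (K * (ENNReal.ofReal ((n : ℝ) ^ (-r / (1 + r))) + approxError vol p₀ F P)))
          ≤ ENNReal.ofReal δ) := by
  refine ⟨fun δ hδ => ?_, fun a b ha hab δ hδ => ?_⟩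
  · obtain ⟨K, hK⟩ := exists_measure_badSamples_le hp₀ hc₀ hp₀_bdd hk hk_meas hC_H hfstar hr
      hdecay hδ
    -- The bound is nonasymptotic, so arbitrary thresholds `1` and `0` will do.
    exact ⟨K, 1, 0, one_pos, fun n η hn hη _ _ P hP => hK n η hn hη P fun q hq => (hP q hq).1⟩
  · obtain ⟨K, hK⟩ := exists_measure_badSamples_le hp₀ hc₀ hp₀_bdd hk hk_meas hC_H hfstar hr
      hdecay hδ
    have hr0 : 0 < r := by linarith
    -- The first summand bounds the ratio of the two rates; the `1` keeps the factor on the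
    -- approximation error at least `1`.
    refine ⟨K * ((a ^ (-1 / r) + b).toNNReal + 1), 0, fun n η hn _ haη hηb P hP => ?_⟩
    have hn' : (0 : ℝ) < n := by exact_mod_cast hn
    set w := (n : ℝ) ^ (-r / (1 + r)) with hw
    have hwpos : 0 < w := Real.rpow_pos_of_pos hn' _
    have hη : 0 < η := (mul_pos ha hwpos).trans_le haη
    refine (measure_mono (badSamples_anti F P n fstar ?_)).trans
      (hK n η hn hη P fun q hq => (hP q hq).1)
    rw [ENNReal.coe_mul, mul_assoc]
    refine mul_le_mul_right ?_ _
    rw [mul_add]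
    refine add_le_add ?_ (le_mul_of_one_le_left zero_le ?_)
    · have h1 : (n : ℝ)⁻¹ * η ^ (-1 / r) ≤ a ^ (-1 / r) * w := by
        have h2 : η ^ (-1 / r) ≤ (a * w) ^ (-1 / r) :=
          Real.rpow_le_rpow_of_nonpos (mul_pos ha hwpos) haη
            (div_nonpos_of_nonpos_of_nonneg (by norm_num) hr0.le)
        -- The choice of exponent balances the stochastic term against the regularization bias.
        have h3 : (n : ℝ)⁻¹ * w ^ (-1 / r) = w := by
          rw [hw, ← Real.rpow_mul hn'.le, ← Real.rpow_neg_one, ← Real.rpow_add hn']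
          congr 1
          field_simp
          ring
        calc (n : ℝ)⁻¹ * η ^ (-1 / r) ≤ (n : ℝ)⁻¹ * (a * w) ^ (-1 / r) :=
              mul_le_mul_of_nonneg_left h2 (by positivity)
          _ = a ^ (-1 / r) * ((n : ℝ)⁻¹ * w ^ (-1 / r)) := by
              rw [Real.mul_rpow ha.le hwpos.le]; ring
          _ = a ^ (-1 / r) * w := by rw [h3]
      have hb : 0 ≤ a ^ (-1 / r) + b := add_nonneg (Real.rpow_nonneg ha.le _) (ha.le.trans hab)
      refine (ENNReal.ofReal_le_ofReal (q := (a ^ (-1 / r) + b) * w) (by linarith)).trans ?_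
      rw [ENNReal.ofReal_mul hb]
      refine mul_le_mul_left ?_ _
      rw [ENNReal.coe_add]
      exact le_self_add
    · rw [ENNReal.coe_add, ENNReal.coe_one]
      exact le_add_self
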